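/- Let $d\ge 1$ and let $\mathfrak G=\{G\subset\mathbb R^d:\operatorname{diam}(G)<1\}$ be equipped with a σ-algebra $\mathcal F$ that contains the events $\{G\cap K\neq\emptyset\}$ and $\{K\subset G\}$ for all compact $K\subset\mathbb R^d$, is stable under translating families of sets and under rescaling families of sets (as long as the rescaled family consists of sets of diameter $<1$), and for which the map $G\mapsto\overline G$ is measurable. Let $\mu$ be a measure on $(\mathfrak G,\mathcal F)$ that is * translation invariant: $\mu(x+\mathcal D)=\mu(\mathcal D)$ for all $\mathcal D\in\mathcal F$ and $x\in\mathbb R^d$, and * semi scale invariant: $\mu(\mathcal D_s)=\mu(\mathcal D)$, where $\mathcal D_s=\{G: G/s\in\mathcal D\}$, whenever $\mathcal D\in\mathcal F$, $\mu(\mathcal D)<\infty$, $0<s<\infty$ and all sets in $\mathcal D_s$ have diameter $<1$. For $0<\lambda<\infty$ let $\Phi_\lambda(\mu)$ be a Poisson process on $\mathfrak G$ with intensity measure $\lambda\mu$, let $$\mathcal C(\lambda)=\mathbb R^d\setminus\bigcup_{G\in\Phi_\lambda(\mu)}G,\qquad \lambda_e(\mu)=\inf\{\lambda>0:\mathbb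 P(\mathcal C(\lambda)=\emptyset)=1\}\in[0,\infty].$$ Suppose that $\mu$ is supported on open sets (i.e. $\mu$-almost every $G$ is open) and that, with $\mathcal L$ denoting Lebesgue measure, 1. $\mu(G: G\cap A\ne\emptyset,\ \operatorname{diam}(G)\ge\delta)<\infty$ for every bounded $A\subset\mathbb R^d$ and every $\delta>0$; 2. $\mu(G:\mathcal L(\partial G)>0)=0$; 3. $\mu(G:\mathcal L(G)>0)>0$. Let $\tilde\mu$ be the image of $\mu$ under the map $G\mapsto\overline G$. Then $\lambda_e(\mu)=\lambda_e(\tilde\mu)$. -/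

import Mathlib

open MeasureTheory ProbabilityTheory
open scoped ENNReal NNReal Pointwise

/-- The space `𝔊` of all subsets of `ℝ^d` of diameter strictly smaller than `1`. -/
structure SmallSet (d : ℕ) where
  /-- the underlying subset of `ℝ^d` -/
  carrier : Set (EuclideanSpace ℝ (Fin d))
  ediam_lt_one : Metric.ediam carrier < 1

namespace SmallSet

variable {d : ℕ}

/-- The translate `x + G`. -/
def translate (x : EuclideanSpace ℝ (Fin d)) (G : SmallSet d) : SmallSet d where
  carrier := x +ᵥ G.carrier
  ediam_lt_one := by
    have h : Metric.ediam (x +ᵥ G.carrier) = Metric.ediam G.carrier :=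
      (isometry_vadd (EuclideanSpace ℝ (Fin d)) x).ediam_image G.carrier
    rw [h]
    exact G.ediam_lt_one

/-- The closure of `G`. -/
def closure (G : SmallSet d) : SmallSet d where
  carrier := _root_.closure G.carrier
  ediam_lt_one := by
    rw [Metric.ediam_closure]
    exact G.ediam_lt_one

/-- The family `𝒟_s = {G : G / s ∈ 𝒟}`, that is, the family of the sets `s H` with `H ∈ 𝒟`.
It is only used when all these sets have diameter smaller than `1`, see `ScalesInto`. -/
def scaleFamily (s : ℝ) (D : Set (SmallSet d)) : Set (SmallSet d) :=
  {G | ∃ H ∈ D, G.carrier = s • H.carrier}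

/-- All the sets `s H`, `H ∈ 𝒟`, have diameter strictly smaller than `1`. -/
def ScalesInto (s : ℝ) (D : Set (SmallSet d)) : Prop :=
  ∀ H ∈ D, Metric.ediam (s • H.carrier) < 1

end SmallSet

/-- A σ-algebra on `𝔊` is suitable if it contains the events that `G` meets, respectively
contains, a given compact set, and is stable under the operations used to formulate the
model: translating and rescaling families of sets, and passing from sets to their closures.
(On the open sets, and on the closed sets, the σ-algebra generated by the first two kinds of
events is the usual Borel σ-algebra of random open, respectively random closed, sets.) -/
structure IsSuitableSigmaAlgebra (d : ℕ) [MeasurableSpace (SmallSet d)] : Prop where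
  hits : ∀ K : Set (EuclideanSpace ℝ (Fin d)), IsCompact K →
    MeasurableSet {G : SmallSet d | (G.carrier ∩ K).Nonempty}
  contains : ∀ K : Set (EuclideanSpace ℝ (Fin d)), IsCompact K →
    MeasurableSet {G : SmallSet d | K ⊆ G.carrier}
  translate : ∀ (x : EuclideanSpace ℝ (Fin d)) (D : Set (SmallSet d)),
    MeasurableSet D → MeasurableSet (SmallSet.translate x '' D)
  scale : ∀ (s : ℝ) (D : Set (SmallSet d)), 0 < s → MeasurableSet D →
    SmallSet.ScalesInto s D → MeasurableSet (SmallSet.scaleFamily s D)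
  closure : Measurable (SmallSet.closure : SmallSet d → SmallSet d)

section Model

variable {d : ℕ} [MeasurableSpace (SmallSet d)]

/-- Semi scale invariance: `μ(𝒟_s) = μ(𝒟)` whenever `μ(𝒟) < ∞`, `0 < s < ∞` and `𝒟_s` only
contains sets of diameter smaller than `1`. -/
def SemiScaleInvariant (μ : Measure (SmallSet d)) : Prop :=
  ∀ (s : ℝ) (D : Set (SmallSet d)), 0 < s → MeasurableSet D → μ D < ∞ →
    SmallSet.ScalesInto s D → μ (SmallSet.scaleFamily s D) = μ D

/-- Translation invariance: `μ(x + 𝒟) = μ(𝒟)`. -/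
def TranslationInvariant (μ : Measure (SmallSet d)) : Prop :=
  ∀ (x : EuclideanSpace ℝ (Fin d)) (D : Set (SmallSet d)), MeasurableSet D →
    μ (SmallSet.translate x '' D) = μ D

/-- Local finiteness: only finite mass is given to the sets of diameter at least `δ` that meet
a given bounded set. -/
def LocallyFiniteModel (μ : Measure (SmallSet d)) : Prop :=
  ∀ A : Set (EuclideanSpace ℝ (Fin d)), Bornology.IsBounded A → ∀ δ : ℝ, 0 < δ →
    μ {G | (G.carrier ∩ A).Nonempty ∧ ENNReal.ofReal δ ≤ Metric.ediam G.carrier} < ∞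

/-- Almost every set has a boundary of Lebesgue measure zero. -/
def NullBoundaries (μ : Measure (SmallSet d)) : Prop :=
  μ {G | 0 < volume (frontier G.carrier)} = 0

/-- Sets of positive Lebesgue measure have positive mass. -/
def PositiveVolumes (μ : Measure (SmallSet d)) : Prop :=
  0 < μ {G | 0 < volume G.carrier}

/-- `μ` is supported on open sets. -/
def SupportedOnOpen (μ : Measure (SmallSet d)) : Prop :=
  ∀ᵐ G ∂μ, IsOpen G.carrier

/-- The measure induced by `μ` by taking closures. -/
noncomputable def closureMeasure (μ : Measure (SmallSet d)) : Measure (SmallSet d) :=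
  μ.map SmallSet.closure

end Model

/-- The Poisson distribution with mean `r ∈ [0, ∞]` on `{0, 1, …, ∞}`; for `r = ∞` it is the
point mass at `∞`. -/
noncomputable def poissonLaw (r : ℝ≥0∞) : Measure ℕ∞ :=
  if r = ∞ then Measure.dirac ⊤ else (poissonMeasure r.toNNReal).map (fun k : ℕ => (k : ℕ∞))

/-- A countable random configuration of points of `X`: the points are `point i ω` for `i : ℕ` with
`i < number ω`, where `number ω ∈ {0, 1, …, ∞}`. -/
structure PointConfiguration (Ω X : Type) where
  /-- the total number of points -/
  number : Ω → ℕ∞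
  /-- the points -/
  point : ℕ → Ω → X

/-- The number of points, with multiplicity, that lie in `A`. -/
noncomputable def PointConfiguration.count {Ω X : Type} (Φ : PointConfiguration Ω X)
    (A : Set X) (ω : Ω) : ℕ∞ :=
  {i : ℕ | (i : ℕ∞) < Φ.number ω ∧ Φ.point i ω ∈ A}.encard

/-- `Φ` is a Poisson process with intensity measure `m`: the number of points in `A` has the
Poisson distribution with mean `m A`, and the numbers of points in finitely many pairwise
disjoint sets are independent. -/
structure IsPoissonProcess {Ω X : Type} [MeasurableSpace Ω] [MeasurableSpace X]
    (P : Measure Ω) (Φ : PointConfiguration Ω X) (m : Measure X) : Prop where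
  measurable_number : Measurable Φ.number
  measurable_point : ∀ i, Measurable (Φ.point i)
  map_count : ∀ A : Set X, MeasurableSet A → P.map (Φ.count A) = poissonLaw (m A)
  indep_count : ∀ (n : ℕ) (A : Fin n → Set X), (∀ i, MeasurableSet (A i)) →
    (Pairwise fun i j => Disjoint (A i) (A j)) → iIndepFun (fun i => Φ.count (A i)) P

/-- The random fractal `𝒞`: the complement of the union of the sets of the process. -/
def fractal {d : ℕ} {Ω : Type} (Φ : PointConfiguration Ω (SmallSet d)) (ω : Ω) :
    Set (EuclideanSpace ℝ (Fin d)) :=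
  (⋃ (i : ℕ) (_ : (i : ℕ∞) < Φ.number ω), (Φ.point i ω).carrier)ᶜ

/-- `ℙ(𝒞 = ∅) = 1` for a Poisson process of intensity measure `m`, whatever the probability
space on which the process is realized. -/
def FractalAlmostSurelyEmpty {d : ℕ} [MeasurableSpace (SmallSet d)]
    (m : Measure (SmallSet d)) : Prop :=
  ∀ (Ω : Type) [MeasurableSpace Ω] (P : Measure Ω) [IsProbabilityMeasure P]
    (Φ : PointConfiguration Ω (SmallSet d)), IsPoissonProcess P Φ m →
      ∀ᵐ ω ∂P, fractal Φ ω = ∅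

/-- The critical value `λ_e(μ) = inf {λ > 0 : ℙ(𝒞(λ) = ∅) = 1}`, where `𝒞(λ)` is built from a
Poisson process with intensity measure `λ μ` (and `inf ∅ = ∞`). -/
noncomputable def existenceCriticalValue {d : ℕ} [MeasurableSpace (SmallSet d)]
    (μ : Measure (SmallSet d)) : ℝ≥0∞ :=
  sInf {l : ℝ≥0∞ | 0 < l ∧ l ≠ ∞ ∧ FractalAlmostSurelyEmpty (l • μ)}

/-! ### Measurability and invariance for random sets, and the dyadic decomposition by diameter. -/

section RandomSets

open Set Filter Topology Metric

/-! Both critical values are computed and turn out to be `d log 2 / c`, where `c = scaleDensity μ`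
is the mass of the sets that contain the origin and have diameter in `[1/2, 1)`. By scale and
translation invariance, each dyadic range of diameters contributes the same mass `c` of sets
covering a given point. A point therefore escapes the sets of diameter at least `2^{-n}` with
probability `exp(-λ c n)`, to be compared with the `2^{dn}` cells of side `2^{-n}` in a unit cube.

Above the threshold a union bound suffices (`fractalAlmostSurelyEmpty_of_le`). Almost every set is
open, so up to a small loss in `c` a set covering a point contains a ball around it of radius
comparable to its own diameter (`tendsto_measure_closedBall_subset`). The mass of the sets
containing a ball of radius `2^{-n}` then grows linearly in `n` with slope close to `c`, and it only
increases when closures are taken.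

Below the threshold the second moment method shows that even the closures fail to cover
(`not_ae_forall_mem_closure_of_exp_lt`), which settles both models at once, since the closure
process is the image of the open one. The sets are thickened by a small multiple `ε` of their
diameter. This preserves scale invariance, makes the uncovered region closed, and changes the mass
per scale by an amount that vanishes as `ε → 0`, because boundaries are Lebesgue null and hence, by
Fubini and translation invariance, almost no set has the origin on its boundary
(`tendsto_measure_relThickening`). The uncovered volume of a ball is positive with probability
bounded below uniformly in the number of scales, and compactness yields a point missed by all
closures.

Emptiness is defined through all realizations of the process, so refuting it requires one
realization: `exists_isPoissonProcess` constructs it for every s-finite intensity. -/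

theorem exists_iUnion_isCompact_of_isOpen {X : Type*} [PseudoMetricSpace X] [ProperSpace X]
    {U : Set X} (hU : IsOpen U) : ∃ K : ℕ → Set X, (∀ n, IsCompact (K n)) ∧ ⋃ n, K n = U := by
  obtain ⟨F, hF, -, hFU, -⟩ := hU.exists_iUnion_isClosed
  refine ⟨fun n => F n.unpair.1 ∩ compactCovering X n.unpair.2,
    fun n => (isCompact_compactCovering X _).inter_left (hF _), ?_⟩
  rw [← hFU]
  ext x
  simp only [mem_iUnion, mem_inter_iff]
  constructor
  · rintro ⟨n, hn, -⟩
    exact ⟨_, hn⟩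
  · rintro ⟨n, hn⟩
    obtain ⟨m, hm⟩ := exists_mem_compactCovering x
    exact ⟨Nat.pair n m, by simpa using ⟨hn, hm⟩⟩

namespace SmallSet

variable {d : ℕ}

theorem carrier_injective : Function.Injective (carrier : SmallSet d → _) := by
  rintro ⟨A, hA⟩ ⟨B, hB⟩ (rfl : A = B)
  rfl

theorem translate_translate (x y : EuclideanSpace ℝ (Fin d)) (G : SmallSet d) :
    translate x (translate y G) = translate (x + y) G :=
  carrier_injective (by simp [translate, vadd_vadd])

theorem translate_zero (G : SmallSet d) : translate 0 G = G :=
  carrier_injective (by simp [translate])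

theorem image_translate (x : EuclideanSpace ℝ (Fin d)) (D : Set (SmallSet d)) :
    translate x '' D = translate (-x) ⁻¹' D := by
  ext G
  constructor
  · rintro ⟨H, hH, rfl⟩
    simpa [translate_translate, translate_zero] using hH
  · intro hG
    exact ⟨_, hG, by simp [translate_translate, translate_zero]⟩

theorem ediam_translate (x : EuclideanSpace ℝ (Fin d)) (G : SmallSet d) :
    ediam (translate x G).carrier = ediam G.carrier :=
  (isometry_vadd (EuclideanSpace ℝ (Fin d)) x).ediam_image G.carrier

theorem infEDist_translate (x y : EuclideanSpace ℝ (Fin d)) (G : SmallSet d) :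
    infEDist (x + y) (translate x G).carrier = infEDist y G.carrier :=
  infEDist_vadd x y G.carrier

end SmallSet

variable {d : ℕ}

/-- The sets whose diameter lies in `[2^{-(k+1)}, 2^{-k})`. -/
def diamShell (d k : ℕ) : Set (SmallSet d) :=
  {G | 2⁻¹ ^ (k + 1) ≤ ediam G.carrier ∧ ediam G.carrier < 2⁻¹ ^ k}

theorem pairwise_disjoint_diamShell : Pairwise (Function.onFun Disjoint (diamShell d)) := by
  have : ∀ i j, i < j → Disjoint (diamShell d i) (diamShell d j) := by
    intro i j hij
    refine Set.disjoint_left.2 fun G hi hj => ?_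
    have h : (2⁻¹ : ℝ≥0∞) ^ j ≤ 2⁻¹ ^ (i + 1) :=
      pow_le_pow_right_of_le_one' (by simp) hij
    exact absurd (hj.2.trans_le h) (not_lt.2 hi.1)
  intro i j hij
  rcases hij.lt_or_gt with h | h
  · exact this i j h
  · exact (this j i h).symm

theorem iUnion_diamShell_lt (n : ℕ) :
    ⋃ k ∈ Finset.range n, diamShell d k = {G | 2⁻¹ ^ n ≤ ediam G.carrier} := by
  induction n with
  | zero =>
    ext G
    simpa using G.ediam_lt_one
  | succ n ih =>
    rw [Finset.range_add_one, Finset.set_biUnion_insert, ih]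
    ext G
    simp only [diamShell, mem_union, mem_ofPred_eq]
    have h : (2⁻¹ : ℝ≥0∞) ^ (n + 1) ≤ 2⁻¹ ^ n :=
      pow_le_pow_right_of_le_one' (by simp) n.le_succ
    rcases lt_or_ge (ediam G.carrier) (2⁻¹ ^ n) with h1 | h1
    · simp [h1, not_le.2 h1]
    · simp [h1, not_lt.2 h1, h.trans h1]

variable [MeasurableSpace (SmallSet d)]

namespace IsSuitableSigmaAlgebra

theorem measurableSet_hits_isOpen (hF : IsSuitableSigmaAlgebra d)
    {U : Set (EuclideanSpace ℝ (Fin d))} (hU : IsOpen U) :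
    MeasurableSet {G : SmallSet d | (G.carrier ∩ U).Nonempty} := by
  obtain ⟨K, hK, rfl⟩ := exists_iUnion_isCompact_of_isOpen hU
  simp only [inter_iUnion, nonempty_iUnion, ofPred_exists]
  exact .iUnion fun n => hF.hits _ (hK n)

theorem measurableSet_contains_isOpen (hF : IsSuitableSigmaAlgebra d)
    {U : Set (EuclideanSpace ℝ (Fin d))} (hU : IsOpen U) :
    MeasurableSet {G : SmallSet d | U ⊆ G.carrier} := by
  obtain ⟨K, hK, rfl⟩ := exists_iUnion_isCompact_of_isOpen hU
  simp only [iUnion_subset_iff, ofPred_forall]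
  exact .iInter fun n => hF.contains _ (hK n)

theorem measurable_infEDist (hF : IsSuitableSigmaAlgebra d) (x : EuclideanSpace ℝ (Fin d)) :
    Measurable fun G : SmallSet d => infEDist x G.carrier := by
  refine measurable_of_Iio fun r => ?_
  convert! hF.measurableSet_hits_isOpen (isOpen_eball (x := x) (ε := r)) using 1
  ext G
  simp [infEDist_lt_iff, Set.Nonempty, edist_comm]

theorem measurable_infEDist_compl (hF : IsSuitableSigmaAlgebra d)
    (x : EuclideanSpace ℝ (Fin d)) :
    Measurable fun G : SmallSet d => infEDist x G.carrierᶜ := by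
  refine measurable_of_Ici fun r => ?_
  convert! hF.measurableSet_contains_isOpen (isOpen_eball (x := x) (ε := r)) using 1
  ext G
  simp only [mem_preimage, mem_Ici, le_infEDist, mem_compl_iff, mem_ofPred_eq, Set.subset_def,
    mem_eball, edist_comm x]
  exact forall_congr' fun y => by rw [← not_lt]; tauto

theorem measurable_infEDist_uncurry (hF : IsSuitableSigmaAlgebra d) :
    Measurable fun p : EuclideanSpace ℝ (Fin d) × SmallSet d => infEDist p.1 p.2.carrier :=
  measurable_uncurry_of_continuous_of_measurable
    (u := fun x (G : SmallSet d) => infEDist x G.carrier)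
    (fun _ => continuous_infEDist) hF.measurable_infEDist

theorem measurable_infEDist_compl_uncurry (hF : IsSuitableSigmaAlgebra d) :
    Measurable fun p : EuclideanSpace ℝ (Fin d) × SmallSet d => infEDist p.1 p.2.carrierᶜ :=
  measurable_uncurry_of_continuous_of_measurable
    (u := fun x (G : SmallSet d) => infEDist x G.carrierᶜ)
    (fun _ => continuous_infEDist) hF.measurable_infEDist_compl

/-- A diameter exceeds `r` exactly when the set meets two members of a countable basis all of whose
cross distances exceed `r`, so only events of hitting open sets are involved. -/
theorem measurable_ediam (hF : IsSuitableSigmaAlgebra d) :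
    Measurable fun G : SmallSet d => ediam G.carrier := by
  refine measurable_of_Ioi fun r => ?_
  obtain ⟨B, hc, -, hB⟩ :=
    TopologicalSpace.exists_countable_basis (EuclideanSpace ℝ (Fin d))
  have hsep : ∀ x y : EuclideanSpace ℝ (Fin d), r < edist x y →
      ∃ U ∈ B, ∃ V ∈ B, (∀ a ∈ U, ∀ b ∈ V, r < edist a b) ∧ x ∈ U ∧ y ∈ V := by
    intro x y hxy
    have hW : IsOpen {p : EuclideanSpace ℝ (Fin d) × EuclideanSpace ℝ (Fin d) |
        r < edist p.1 p.2} := isOpen_lt continuous_const continuous_edist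
    obtain ⟨u, v, hu, hv, hxu, hyv, huv⟩ := isOpen_prod_iff.1 hW x y
      (by simpa only [mem_ofPred_eq] using hxy)
    obtain ⟨U, hU, hxU, hUu⟩ := hB.exists_subset_of_mem_open hxu hu
    obtain ⟨V, hV, hyV, hVv⟩ := hB.exists_subset_of_mem_open hyv hv
    refine ⟨U, hU, V, hV, fun a ha b hb => ?_, hxU, hyV⟩
    simpa only [mem_ofPred_eq] using huv (mk_mem_prod (hUu ha) (hVv hb))
  have key : (fun G : SmallSet d => ediam G.carrier) ⁻¹' Ioi r =
      ⋃ U ∈ B, ⋃ V ∈ B, ⋃ _ : ∀ a ∈ U, ∀ b ∈ V, r < edist a b,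
        {G : SmallSet d | (G.carrier ∩ U).Nonempty} ∩ {G | (G.carrier ∩ V).Nonempty} := by
    ext G
    rw [mem_preimage, mem_Ioi]
    simp only [mem_iUnion, exists_prop]
    constructor
    · intro h
      obtain ⟨x, hx, y, hy, hxy⟩ : ∃ x ∈ G.carrier, ∃ y ∈ G.carrier, r < edist x y := by
        by_contra! hc
        exact absurd (ediam_le hc) (not_le.2 h)
      obtain ⟨U, hU, V, hV, hUV, hxU, hyV⟩ := hsep x y hxy
      exact ⟨U, hU, V, hV, hUV, ⟨x, hx, hxU⟩, ⟨y, hy, hyV⟩⟩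
    · rintro ⟨U, -, V, -, hUV, ⟨x, hx, hxU⟩, ⟨y, hy, hyV⟩⟩
      exact (hUV x hxU y hyV).trans_le (edist_le_ediam_of_mem hx hy)
  rw [key]
  refine .biUnion hc fun U hU => .biUnion hc fun V hV => .iUnion fun _ => ?_
  exact (hF.measurableSet_hits_isOpen (hB.isOpen hU)).inter
    (hF.measurableSet_hits_isOpen (hB.isOpen hV))

end IsSuitableSigmaAlgebra

theorem TranslationInvariant.measure_preimage_translate {μ : Measure (SmallSet d)}
    (htrans : TranslationInvariant μ) (x : EuclideanSpace ℝ (Fin d)) {D : Set (SmallSet d)}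
    (hD : MeasurableSet D) : μ (SmallSet.translate x ⁻¹' D) = μ D := by
  have := htrans (-x) D hD
  rwa [SmallSet.image_translate, neg_neg] at this

theorem measurableSet_diamShell (hF : IsSuitableSigmaAlgebra d) (k : ℕ) :
    MeasurableSet (diamShell d k) :=
  hF.measurable_ediam measurableSet_Ico

/-- Events concerning sets of comparable size have the same mass at all dyadic scales. -/
theorem SemiScaleInvariant.measure_diamShell {μ : Measure (SmallSet d)}
    (hscale : SemiScaleInvariant μ) (q : Set (EuclideanSpace ℝ (Fin d)) → Prop) (k : ℕ)
    (hm : MeasurableSet ({G | q G.carrier} ∩ diamShell d 0))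
    (hfin : μ ({G | q G.carrier} ∩ diamShell d 0) < ∞) :
    μ ({G | q ((2 ^ k : ℝ) • G.carrier)} ∩ diamShell d k) =
      μ ({G | q G.carrier} ∩ diamShell d 0) := by
  -- Semi scale invariance is applied with factor `2^{-k}`, which carries the shell of diameters
  -- `[1/2, 1)` onto the `k`-th one.
  have hs : (0 : ℝ) < (2 ^ k)⁻¹ := by positivity
  have hn : ((‖((2 : ℝ) ^ k)⁻¹‖₊ : ℝ≥0) : ℝ≥0∞) = 2⁻¹ ^ k := by
    rw [nnnorm_inv, nnnorm_pow, ENNReal.coe_inv (by simp), ENNReal.coe_pow, ENNReal.inv_pow]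
    simp
  have hdiam : ∀ A : Set (EuclideanSpace ℝ (Fin d)),
      ediam (((2 : ℝ) ^ k)⁻¹ • A) = 2⁻¹ ^ k * ediam A := by
    intro A
    rw [ediam_smul₀, ENNReal.smul_def, hn, smul_eq_mul]
  have hpow0 : (2⁻¹ : ℝ≥0∞) ^ k ≠ 0 := by simp
  have hpowt : (2⁻¹ : ℝ≥0∞) ^ k ≠ ∞ := by simp
  have hinto : SmallSet.ScalesInto ((2 : ℝ) ^ k)⁻¹ ({G | q G.carrier} ∩ diamShell d 0) := by
    intro H _
    rw [hdiam]
    calc 2⁻¹ ^ k * ediam H.carrier ≤ 1 * ediam H.carrier := by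
          gcongr
          exact pow_le_one' (by simp) k
      _ < 1 := by simpa using H.ediam_lt_one
  rw [← hscale _ _ hs hm hfin hinto]
  congr 1
  ext G
  simp only [SmallSet.scaleFamily, diamShell, mem_inter_iff, mem_ofPred_eq]
  have hcancel : ∀ A : Set (EuclideanSpace ℝ (Fin d)),
      ((2 : ℝ) ^ k)⁻¹ • ((2 : ℝ) ^ k) • A = A := fun A => inv_smul_smul₀ (by positivity) A
  have hcancel' : ∀ A : Set (EuclideanSpace ℝ (Fin d)),
      ((2 : ℝ) ^ k) • ((2 : ℝ) ^ k)⁻¹ • A = A := fun A => smul_inv_smul₀ (by positivity) A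
  constructor
  · rintro ⟨hq, h1, h2⟩
    have hd := hdiam ((2 : ℝ) ^ k • G.carrier)
    rw [hcancel] at hd
    rw [hd, pow_succ] at h1
    rw [hd] at h2
    have h2' : ediam ((2 : ℝ) ^ k • G.carrier) < 1 := by
      rw [← ENNReal.mul_lt_mul_iff_right hpow0 hpowt]
      simpa using h2
    refine ⟨⟨_, h2'⟩, ⟨hq, ?_, by simpa using h2'⟩, (hcancel _).symm⟩
    rw [← ENNReal.mul_le_mul_iff_right hpow0 hpowt]
    simpa using h1
  · rintro ⟨H, ⟨hq, h1, h2⟩, hG⟩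
    rw [hG, hcancel', hdiam]
    refine ⟨hq, ?_, ?_⟩
    · rw [pow_succ]
      gcongr
      simpa using h1
    · calc (2⁻¹ : ℝ≥0∞) ^ k * ediam H.carrier < 2⁻¹ ^ k * 1 := by
            rw [ENNReal.mul_lt_mul_iff_right hpow0 hpowt]
            exact H.ediam_lt_one
        _ = _ := mul_one _

theorem LocallyFiniteModel.measure_diamShell_lt_top {μ : Measure (SmallSet d)}
    (h1 : LocallyFiniteModel μ) {A : Set (EuclideanSpace ℝ (Fin d))}
    (hA : Bornology.IsBounded A) (k : ℕ) :
    μ ({G | (G.carrier ∩ A).Nonempty} ∩ diamShell d k) < ∞ := by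
  refine (measure_mono ?_).trans_lt (h1 A hA (2⁻¹ ^ (k + 1)) (by positivity))
  rintro G ⟨hG, h, -⟩
  refine ⟨hG, le_of_eq_of_le ?_ h⟩
  rw [ENNReal.ofReal_pow (by norm_num), ENNReal.ofReal_inv_of_pos (by norm_num)]
  simp

end RandomSets

/-! ### S-finiteness, stationarity, and the mass per dyadic scale. -/

section ScaleDensity

open Set Filter Topology Metric

variable {d : ℕ}

theorem eq_empty_of_isOpen_of_ediam_eq_zero (hd : 1 ≤ d) {U : Set (EuclideanSpace ℝ (Fin d))}
    (hU : IsOpen U) (h0 : ediam U = 0) : U = ∅ := by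
  have : Nonempty (Fin d) := ⟨⟨0, hd⟩⟩
  rcases (ediam_eq_zero_iff.1 h0).eq_empty_or_singleton with h | ⟨x, rfl⟩
  · exact h
  · exact absurd hU (not_isOpen_singleton x)

variable [MeasurableSpace (SmallSet d)] {μ : Measure (SmallSet d)}

theorem SupportedOnOpen.ae_eq_empty_or_ediam_ne_zero (hd : 1 ≤ d) (hopen : SupportedOnOpen μ) :
    ∀ᵐ G ∂μ, G.carrier = ∅ ∨ ediam G.carrier ≠ 0 := by
  filter_upwards [hopen] with G hG
  by_cases h : ediam G.carrier = 0
  · exact .inl (eq_empty_of_isOpen_of_ediam_eq_zero hd hG h)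
  · exact .inr h

/-- Local finiteness exhausts the nonempty sets of positive diameter by events of finite mass. An
open set of diameter zero is empty when `d ≥ 1`, so all that remains is an atom at `∅`, whose mass
may be infinite: s-finiteness is available where σ-finiteness may fail. -/
theorem sFinite_of_locallyFiniteModel (hd : 1 ≤ d) (hF : IsSuitableSigmaAlgebra d)
    (hopen : SupportedOnOpen μ) (h1 : LocallyFiniteModel μ) : SFinite μ := by
  let S : ℕ → Set (SmallSet d) := fun n =>
    {G | (G.carrier ∩ closedBall 0 n).Nonempty} ∩ {G | ENNReal.ofReal (2⁻¹ ^ n) ≤ ediam G.carrier}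
  have hS : ∀ n, MeasurableSet (S n) := fun n =>
    (hF.hits _ (isCompact_closedBall _ _)).inter (hF.measurable_ediam measurableSet_Ici)
  have hSfin : ∀ n, μ (S n) < ∞ := fun n =>
    h1 _ isBounded_closedBall _ (by positivity)
  have hmemS : ∀ G : SmallSet d, G.carrier.Nonempty → ediam G.carrier ≠ 0 → G ∈ ⋃ n, S n := by
    rintro G ⟨x, hx⟩ h0
    obtain ⟨n, hn⟩ := exists_nat_ge ‖x‖
    have ht : Tendsto (fun m : ℕ => ENNReal.ofReal (2⁻¹ ^ m)) atTop (𝓝 0) := by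
      rw [← ENNReal.ofReal_zero]
      exact ENNReal.tendsto_ofReal
        (tendsto_pow_atTop_nhds_zero_of_lt_one (by norm_num) (by norm_num))
    obtain ⟨m, hm, hnm⟩ := ((ht.eventually_lt_const (pos_iff_ne_zero.2 h0)).and
      (eventually_ge_atTop n)).exists
    refine mem_iUnion.2 ⟨m, ⟨x, hx, ?_⟩, hm.le⟩
    rw [mem_closedBall_zero_iff]
    exact hn.trans (by exact_mod_cast hnm)
  let N : Set (SmallSet d) := (⋃ n, S n)ᶜ
  have hN : MeasurableSet N := (MeasurableSet.iUnion hS).compl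
  have hsum : μ.restrict (⋃ n, S n) = Measure.sum fun n => μ.restrict (disjointed S n) := by
    rw [← iUnion_disjointed]
    exact Measure.restrict_iUnion (disjoint_disjointed S) fun n => .disjointed hS n
  have hfin : ∀ n, IsFiniteMeasure (μ.restrict (disjointed S n)) := fun n =>
    ⟨by simpa using (measure_mono (disjointed_subset S n)).trans_lt (hSfin n)⟩
  let e : SmallSet d := ⟨∅, by simp⟩
  have hdirac : μ.restrict N = μ N • Measure.dirac e := by
    have hae : ∀ᵐ G ∂μ.restrict N, G = e := by
      rw [ae_restrict_iff' hN]
      filter_upwards [hopen.ae_eq_empty_or_ediam_ne_zero hd] with G hG hGN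
      rcases hG with hG | hG
      · exact SmallSet.carrier_injective hG
      · by_contra hne
        refine hGN (hmemS G (nonempty_iff_ne_empty.2 fun h => hne ?_) hG)
        exact SmallSet.carrier_injective h
    ext A hA
    rw [Measure.smul_apply, Measure.dirac_apply' _ hA, smul_eq_mul]
    by_cases he : e ∈ A
    · rw [indicator_of_mem he, Pi.one_apply, mul_one, ← Measure.restrict_apply_univ N]
      refine measure_congr ?_
      filter_upwards [hae] with G hG
      simp only [eq_iff_iff]
      subst hG
      exact ⟨fun _ => trivial, fun _ => he⟩
    · rw [indicator_of_notMem he, mul_zero]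
      refine measure_mono_null ?_ (ae_iff.1 hae)
      rintro G hG rfl
      exact he hG
  have : μ = μ.restrict (⋃ n, S n) + μ.restrict N :=
    (Measure.restrict_add_restrict_compl (MeasurableSet.iUnion hS)).symm
  rw [this, hsum, hdirac]
  infer_instance

/-- A stationary random field of events has expected volume proportional to its mass at `0`. -/
theorem TranslationInvariant.lintegral_volume_section [SFinite μ] (htrans : TranslationInvariant μ)
    {W : Set (EuclideanSpace ℝ (Fin d) × SmallSet d)} (hW : MeasurableSet W)
    (hcov : ∀ x G, (x, SmallSet.translate x G) ∈ W ↔ (0, G) ∈ W) :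
    ∫⁻ G, volume ((fun x => (x, G)) ⁻¹' W) ∂μ =
      μ {G | (0, G) ∈ W} * volume (univ : Set (EuclideanSpace ℝ (Fin d))) := by
  have hx : ∀ x, μ (Prod.mk x ⁻¹' W) = μ {G | (0, G) ∈ W} := by
    intro x
    rw [← htrans.measure_preimage_translate x (measurable_prodMk_left hW)]
    congr 1
    ext G
    exact hcov x G
  calc ∫⁻ G, volume ((fun x => (x, G)) ⁻¹' W) ∂μ = (volume.prod μ) W :=
        (Measure.prod_apply_symm hW).symm
    _ = ∫⁻ x, μ (Prod.mk x ⁻¹' W) := Measure.prod_apply hW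
    _ = _ := by simp [hx]

/-- The integral of the boundary volumes vanishes, and by stationarity it equals this mass times the
infinite, in particular nonzero, volume of the space. -/
theorem measure_zero_mem_frontier [SFinite μ] (hF : IsSuitableSigmaAlgebra d)
    (htrans : TranslationInvariant μ) (h2 : NullBoundaries μ) :
    μ {G | 0 ∈ frontier G.carrier} = 0 := by
  let W : Set (EuclideanSpace ℝ (Fin d) × SmallSet d) :=
    {p | infEDist p.1 p.2.carrier = 0} ∩ {p | infEDist p.1 p.2.carrierᶜ = 0}
  have hWmem : ∀ x G, (x, G) ∈ W ↔ x ∈ frontier G.carrier := by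
    intro x G
    rw [frontier_eq_closure_inter_closure, mem_inter_iff x (closure _),
      mem_closure_iff_infEDist_zero, mem_closure_iff_infEDist_zero]
    rfl
  have hW : MeasurableSet W :=
    (hF.measurable_infEDist_uncurry (measurableSet_singleton 0)).inter
      (hF.measurable_infEDist_compl_uncurry (measurableSet_singleton 0))
  have key := htrans.lintegral_volume_section hW fun x G => by
    rw [hWmem, hWmem]
    have h : frontier (SmallSet.translate x G).carrier = x +ᵥ frontier G.carrier :=
      ((Homeomorph.vadd x).image_frontier G.carrier).symm
    rw [h]
    simpa using vadd_mem_vadd_set_iff (a := x) (s := frontier G.carrier)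
      (x := (0 : EuclideanSpace ℝ (Fin d)))
  have hzero : ∫⁻ G, volume ((fun x => (x, G)) ⁻¹' W) ∂μ = 0 := by
    rw [lintegral_eq_zero_iff' (measurable_measure_prodMk_right hW).aemeasurable]
    refine measure_mono_null ?_ h2
    intro G hG
    rw [mem_ofPred_eq, pos_iff_ne_zero]
    simpa [hWmem, preimage] using hG
  rw [hzero] at key
  have := (mul_eq_zero.1 key.symm).resolve_right
    (isOpen_univ.measure_ne_zero volume univ_nonempty)
  simpa only [hWmem] using this

/-- The mass of the sets that contain the origin and have diameter in `[1/2, 1)`. -/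
noncomputable def scaleDensity (μ : Measure (SmallSet d)) : ℝ≥0∞ :=
  μ ({G | 0 ∈ G.carrier} ∩ diamShell d 0)

theorem IsSuitableSigmaAlgebra.measurableSet_mem (hF : IsSuitableSigmaAlgebra d)
    (x : EuclideanSpace ℝ (Fin d)) : MeasurableSet {G : SmallSet d | x ∈ G.carrier} := by
  simpa using hF.contains {x} isCompact_singleton

theorem scaleDensity_lt_top (h1 : LocallyFiniteModel μ) : scaleDensity μ < ∞ := by
  refine (measure_mono ?_).trans_lt
    (h1.measure_diamShell_lt_top (Bornology.isBounded_singleton (x := 0)) 0)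
  exact inter_subset_inter_left _ fun G hG => ⟨0, hG, rfl⟩

/-- If the density vanished, scale invariance would make it vanish in every shell, so almost no set
would have the origin in its interior. Stationarity would then give almost every set volume zero. -/
theorem scaleDensity_pos [SFinite μ] (hd : 1 ≤ d) (hF : IsSuitableSigmaAlgebra d)
    (hscale : SemiScaleInvariant μ) (htrans : TranslationInvariant μ)
    (hopen : SupportedOnOpen μ) (h1 : LocallyFiniteModel μ) (h3 : PositiveVolumes μ) :
    0 < scaleDensity μ := by
  by_contra hneg
  have hc : scaleDensity μ = 0 := by simpa using hneg
  let W : Set (EuclideanSpace ℝ (Fin d) × SmallSet d) := {p | infEDist p.1 p.2.carrierᶜ ≠ 0}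
  have hWmem : ∀ x G, (x, G) ∈ W ↔ x ∈ interior G.carrier := by
    intro x G
    rw [interior_eq_compl_closure_compl, mem_compl_iff, mem_closure_iff_infEDist_zero]
    rfl
  have hW : MeasurableSet W :=
    hF.measurable_infEDist_compl_uncurry (measurableSet_singleton 0).compl
  have key := htrans.lintegral_volume_section hW fun x G => by
    rw [hWmem, hWmem]
    have h : interior (SmallSet.translate x G).carrier = x +ᵥ interior G.carrier :=
      ((Homeomorph.vadd x).image_interior G.carrier).symm
    rw [h]
    simpa using vadd_mem_vadd_set_iff (a := x) (s := interior G.carrier)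
      (x := (0 : EuclideanSpace ℝ (Fin d)))
  have hnull : μ {G | (0, G) ∈ W} = 0 := by
    have hk : ∀ k, μ ({G | 0 ∈ G.carrier} ∩ diamShell d k) = 0 := by
      intro k
      have := hscale.measure_diamShell (fun A => 0 ∈ A) k
        ((hF.measurableSet_mem 0).inter (measurableSet_diamShell hF 0))
        (scaleDensity_lt_top h1)
      rw [← hc, scaleDensity, ← this]
      congr 2
      ext G
      simp [mem_smul_set]
    refine measure_mono_null ?_ (measure_union_null (measure_iUnion_null hk)
      (ae_iff.1 (hopen.ae_eq_empty_or_ediam_ne_zero hd)))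
    intro G hG
    have h0 : 0 ∈ G.carrier := interior_subset ((hWmem 0 G).1 hG)
    by_cases hdiam : ediam G.carrier = 0
    · right
      simp only [mem_ofPred_eq, not_or, not_not]
      exact ⟨fun h => by simp [h] at h0, hdiam⟩
    · left
      have ht : Tendsto (fun m : ℕ => (2⁻¹ : ℝ≥0∞) ^ m) atTop (𝓝 0) :=
        ENNReal.tendsto_pow_atTop_nhds_zero_of_lt_one (by simp)
      obtain ⟨m, hm⟩ := (ht.eventually_lt_const (pos_iff_ne_zero.2 hdiam)).exists
      have hmem : G ∈ ⋃ k ∈ Finset.range m, diamShell d k := by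
        rw [iUnion_diamShell_lt]
        exact hm.le
      simp only [mem_iUnion] at hmem ⊢
      obtain ⟨k, -, hk⟩ := hmem
      exact ⟨k, h0, hk⟩
  rw [hnull, zero_mul, lintegral_eq_zero_iff' (measurable_measure_prodMk_right hW).aemeasurable]
    at key
  refine h3.ne' ?_
  have : ∀ᵐ G ∂μ, volume G.carrier = 0 := by
    filter_upwards [key, hopen] with G hG hGo
    simpa [hWmem, hGo.interior_eq, preimage] using hG
  simpa [ae_iff, pos_iff_ne_zero] using this

end ScaleDensity

/-! ### Covering above the threshold by a union bound. -/

section Covering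

open Set Filter Topology Metric

variable {d : ℕ} [MeasurableSpace (SmallSet d)] {μ : Measure (SmallSet d)}

/-- An open set containing the origin contains some ball around it, so this is continuity of the
measure from below. -/
theorem tendsto_measure_closedBall_subset (hopen : SupportedOnOpen μ) :
    Tendsto (fun j : ℕ => μ ({G | closedBall 0 (2⁻¹ ^ j) ⊆ G.carrier} ∩ diamShell d 0)) atTop
      (𝓝 (scaleDensity μ)) := by
  have hmono : Monotone fun j : ℕ =>
      {G : SmallSet d | closedBall 0 (2⁻¹ ^ j) ⊆ G.carrier} ∩ diamShell d 0 := by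
    intro i j hij
    refine inter_subset_inter_left _ fun G hG => Subset.trans ?_ hG
    exact closedBall_subset_closedBall
      (pow_le_pow_of_le_one (by norm_num) (by norm_num) hij)
  convert! tendsto_measure_iUnion_atTop hmono using 2
  refine measure_congr ?_
  filter_upwards [hopen] with G hG
  simp only [eq_iff_iff]
  constructor
  · rintro ⟨h0, hs⟩
    obtain ⟨ε, hε, hball⟩ := Metric.isOpen_iff.1 hG 0 h0
    obtain ⟨j, hj⟩ := exists_pow_lt_of_lt_one hε (by norm_num : (2⁻¹ : ℝ) < 1)
    exact mem_iUnion.2 ⟨j, (closedBall_subset_ball hj).trans hball, hs⟩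
  · intro h
    obtain ⟨j, hj, hs⟩ := mem_iUnion.1 h
    exact ⟨hj (mem_closedBall_self (by positivity)), hs⟩

/-- The mass of the sets containing a ball of radius `2^{-n}` grows at least linearly in `n`. -/
theorem le_measure_closedBall_subset (hF : IsSuitableSigmaAlgebra d)
    (hscale : SemiScaleInvariant μ) (htrans : TranslationInvariant μ)
    (h1 : LocallyFiniteModel μ) (x : EuclideanSpace ℝ (Fin d)) (J n : ℕ) :
    (n - J : ℕ) * μ ({G | closedBall 0 (2⁻¹ ^ J) ⊆ G.carrier} ∩ diamShell d 0) ≤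
      μ {G | closedBall x (2⁻¹ ^ n) ⊆ G.carrier} := by
  have hm : ∀ r, MeasurableSet {G : SmallSet d | closedBall 0 r ⊆ G.carrier} :=
    fun r => hF.contains _ (isCompact_closedBall _ _)
  have htr : μ {G | closedBall x (2⁻¹ ^ n) ⊆ G.carrier} =
      μ {G | closedBall 0 (2⁻¹ ^ n) ⊆ G.carrier} := by
    rw [← htrans.measure_preimage_translate x (hF.contains _ (isCompact_closedBall x _))]
    congr 1
    ext G
    have : closedBall x ((2⁻¹ : ℝ) ^ n) = 
        x +ᵥ closedBall (0 : EuclideanSpace ℝ (Fin d)) (2⁻¹ ^ n) := by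
      simp
    rw [mem_preimage, mem_ofPred_eq, mem_ofPred_eq, this]
    exact vadd_set_subset_vadd_set_iff
  -- Enlarging the `k`-th shell by `2^k` turns the radius `2^{-n}` into `2^{-(n-k)}`, which is at
  -- most `2^{-J}` since `k < n - J`.
  have hshell : ∀ k < n - J,
      μ ({G | closedBall 0 (2⁻¹ ^ J) ⊆ G.carrier} ∩ diamShell d 0) ≤
        μ ({G | closedBall 0 (2⁻¹ ^ n) ⊆ G.carrier} ∩ diamShell d k) := by
    intro k hk
    have hfin : μ ({G | closedBall 0 (2⁻¹ ^ (n - k)) ⊆ G.carrier} ∩ diamShell d 0) < ∞ := by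
      refine (measure_mono (inter_subset_inter_left _ fun G hG => ?_)).trans_lt
        (h1.measure_diamShell_lt_top (Bornology.isBounded_singleton (x := 0)) 0)
      exact ⟨0, hG (mem_closedBall_self (by positivity)), rfl⟩
    have := hscale.measure_diamShell (fun A => closedBall 0 (2⁻¹ ^ (n - k)) ⊆ A) k
      ((hm _).inter (measurableSet_diamShell hF 0)) hfin
    have hset : ∀ A : Set (EuclideanSpace ℝ (Fin d)),
        closedBall 0 (2⁻¹ ^ (n - k)) ⊆ (2 ^ k : ℝ) • A ↔ closedBall 0 (2⁻¹ ^ n) ⊆ A := by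
      intro A
      have : closedBall (0 : EuclideanSpace ℝ (Fin d)) (2⁻¹ ^ (n - k)) =
          (2 ^ k : ℝ) • closedBall 0 (2⁻¹ ^ n) := by
        rw [_root_.smul_closedBall' (by positivity)]
        congr 1
        · simp
        · have h2 : (2⁻¹ : ℝ) ^ n = 2⁻¹ ^ (n - k) * 2⁻¹ ^ k := by
            rw [← pow_add]
            congr 1
            omega
          rw [h2, Real.norm_of_nonneg (by positivity), mul_left_comm, ← mul_pow]
          simp
      rw [this, smul_set_subset_smul_set_iff₀ (by positivity)]
    simp only [hset] at this
    rw [this]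
    refine measure_mono (inter_subset_inter_left _ fun G hG => Subset.trans ?_ hG)
    exact closedBall_subset_closedBall
      (pow_le_pow_of_le_one (by norm_num) (by norm_num) (by omega))
  calc (n - J : ℕ) * μ ({G | closedBall 0 (2⁻¹ ^ J) ⊆ G.carrier} ∩ diamShell d 0)
      = ∑ k ∈ Finset.range (n - J),
          μ ({G | closedBall 0 (2⁻¹ ^ J) ⊆ G.carrier} ∩ diamShell d 0) := by simp
    _ ≤ ∑ k ∈ Finset.range (n - J),
          μ ({G | closedBall 0 (2⁻¹ ^ n) ⊆ G.carrier} ∩ diamShell d k) :=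
        Finset.sum_le_sum fun k hk => hshell k (Finset.mem_range.1 hk)
    _ = μ (⋃ k ∈ Finset.range (n - J),
          {G | closedBall 0 (2⁻¹ ^ n) ⊆ G.carrier} ∩ diamShell d k) := by
        rw [measure_biUnion_finset]
        · intro i _ j _ hij
          exact (pairwise_disjoint_diamShell hij).mono inter_subset_right inter_subset_right
        · exact fun k _ => (hm _).inter (measurableSet_diamShell hF k)
    _ ≤ μ {G | closedBall 0 (2⁻¹ ^ n) ⊆ G.carrier} :=
        measure_mono (iUnion₂_subset fun k _ => inter_subset_left)
    _ = _ := htr.symm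

theorem PointConfiguration.count_eq_zero_iff {Ω X : Type} (Φ : PointConfiguration Ω X)
    (A : Set X) (ω : Ω) :
    Φ.count A ω = 0 ↔ ∀ i : ℕ, (i : ℕ∞) < Φ.number ω → Φ.point i ω ∉ A := by
  simp [PointConfiguration.count, eq_empty_iff_forall_notMem]

theorem PointConfiguration.count_eq_zero_mono {Ω X : Type} (Φ : PointConfiguration Ω X)
    {A B : Set X} (h : A ⊆ B) {ω : Ω} (hB : Φ.count B ω = 0) : Φ.count A ω = 0 := by
  rw [PointConfiguration.count_eq_zero_iff] at hB ⊢
  exact fun i hi hA => hB i hi (h hA)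

theorem PointConfiguration.measurableSet_count_eq_zero {Ω X Y : Type} [MeasurableSpace Ω]
    [MeasurableSpace X] [MeasurableSpace Y] {Φ : PointConfiguration Ω X}
    (hN : Measurable Φ.number) (hp : ∀ i, Measurable (Φ.point i)) {W : Set (Y × X)}
    (hW : MeasurableSet W) :
    MeasurableSet {q : Y × Ω | Φ.count (Prod.mk q.1 ⁻¹' W) q.2 = 0} := by
  simp only [PointConfiguration.count_eq_zero_iff, mem_preimage, ofPred_forall]
  refine .iInter fun i => ?_
  have h : {q : Y × Ω | (i : ℕ∞) < Φ.number q.2 → (q.1, Φ.point i q.2) ∉ W} =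
      {q | (i : ℕ∞) < Φ.number q.2}ᶜ ∪ {q | (q.1, Φ.point i q.2) ∈ W}ᶜ := by
    ext q
    simp only [mem_ofPred_eq, mem_union, mem_compl_iff]
    tauto
  simp only [imp_iff_not_or, ofPred_or] at h ⊢
  refine MeasurableSet.union ?_ ?_
  · exact (hN.comp measurable_snd (MeasurableSet.of_discrete (s := Ioi (i : ℕ∞)))).compl
  · exact (measurable_fst.prodMk ((hp i).comp measurable_snd) hW).compl

theorem poissonLaw_singleton_zero (r : ℝ≥0∞) (hr : r ≠ ∞) :
    poissonLaw r {0} = ENNReal.ofReal (Real.exp (-r.toReal)) := by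
  rw [poissonLaw, if_neg hr, Measure.map_apply .of_discrete (measurableSet_singleton _)]
  have : (fun k : ℕ => (k : ℕ∞)) ⁻¹' {0} = {0} := by
    ext k
    simp
  rw [this, poissonMeasure_singleton]
  simp [ENNReal.toReal]

instance (r : ℝ≥0∞) : IsProbabilityMeasure (poissonLaw r) := by
  unfold poissonLaw
  split_ifs
  · infer_instance
  · exact Measure.isProbabilityMeasure_map .of_discrete

variable {Ω X : Type} [MeasurableSpace Ω] [MeasurableSpace X] {P : Measure Ω}
  {Φ : PointConfiguration Ω X} {m : Measure X}

/-- `Measure.map` along a function that is not a.e. measurable is zero by convention, whereas the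
Poisson law is a probability measure. -/
theorem IsPoissonProcess.aemeasurable_count (hΦ : IsPoissonProcess P Φ m) {A : Set X}
    (hA : MeasurableSet A) : AEMeasurable (Φ.count A) P := by
  by_contra h
  have := hΦ.map_count A hA
  rw [Measure.map_of_not_aemeasurable h] at this
  exact (IsProbabilityMeasure.ne_zero (poissonLaw (m A))) this.symm

theorem IsPoissonProcess.measure_count_eq_zero (hΦ : IsPoissonProcess P Φ m) {A : Set X}
    (hA : MeasurableSet A) (hfin : m A ≠ ∞) :
    P {ω | Φ.count A ω = 0} = ENNReal.ofReal (Real.exp (-(m A).toReal)) := by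
  rw [← poissonLaw_singleton_zero _ hfin, ← hΦ.map_count A hA,
    Measure.map_apply_of_aemeasurable (hΦ.aemeasurable_count hA) (measurableSet_singleton _)]
  rfl

theorem IsPoissonProcess.measure_count_eq_zero_le (hΦ : IsPoissonProcess P Φ m) {A : Set X}
    (hA : MeasurableSet A) {r : ℝ} (hr : ENNReal.ofReal r ≤ m A) :
    P {ω | Φ.count A ω = 0} ≤ ENNReal.ofReal (Real.exp (-r)) := by
  by_cases hfin : m A = ∞
  · have h := Measure.map_apply_of_aemeasurable (hΦ.aemeasurable_count hA)
      (measurableSet_singleton 0)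
    rw [hΦ.map_count A hA, poissonLaw, if_pos hfin] at h
    refine (le_of_eq (h.symm.trans ?_)).trans zero_le
    simp
  · rw [hΦ.measure_count_eq_zero hA hfin]
    gcongr
    exact (ENNReal.ofReal_le_iff_le_toReal hfin).1 hr

/-- If the mass of the sets containing a ball of radius `2^{-n}` is at least `a n - b` with
`a > d log 2`, then the sets of the process cover the whole space. -/
theorem fractalAlmostSurelyEmpty_of_le (hd : 1 ≤ d) (hF : IsSuitableSigmaAlgebra d)
    {m : Measure (SmallSet d)} {a b : ℝ} (ha : d * Real.log 2 < a)
    (hm : ∀ x (n : ℕ),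
      ENNReal.ofReal (a * n - b) ≤ m {G | closedBall x (2⁻¹ ^ n) ⊆ G.carrier}) :
    FractalAlmostSurelyEmpty m := by
  intro Ω _ P _ Φ hΦ
  -- With mesh `2^{-n}/d`, rounding down every coordinate moves a point by at most `√d · 2^{-n}/d ≤
  -- 2^{-n}`.
  let pt : ℕ → (Fin d → ℤ) → EuclideanSpace ℝ (Fin d) := fun n z =>
    WithLp.toLp 2 fun i => (z i : ℝ) / (d * 2 ^ n)
  have hd0 : (0 : ℝ) < d := by exact_mod_cast hd
  have hd1 : (1 : ℝ) ≤ d := by exact_mod_cast hd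
  have happrox : ∀ (M n : ℕ) (x : EuclideanSpace ℝ (Fin d)), (∀ i, |x i| ≤ M) →
      ∃ z ∈ Fintype.piFinset fun _ : Fin d =>
        Finset.Icc (-(M * (d * 2 ^ n) : ℤ)) (M * (d * 2 ^ n)),
        x ∈ closedBall (pt n z) (2⁻¹ ^ n) := by
    intro M n x hx
    have hD : (0 : ℝ) < d * 2 ^ n := by positivity
    refine ⟨fun i => ⌊x i * (d * 2 ^ n)⌋, ?_, ?_⟩
    · rw [Fintype.mem_piFinset]
      intro i
      rw [Finset.mem_Icc]
      have h := abs_le.1 (hx i)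
      constructor
      · rw [Int.le_floor]
        push_cast
        nlinarith [h.1]
      · have h3 : (⌊x i * (d * 2 ^ n)⌋ : ℝ) ≤ M * (d * 2 ^ n) :=
          (Int.floor_le _).trans (by nlinarith [h.2])
        exact_mod_cast h3
    · rw [mem_closedBall, EuclideanSpace.dist_eq]
      have hcoord : ∀ i, dist (x i) (pt n (fun i => ⌊x i * (d * 2 ^ n)⌋) i) ^ 2 ≤
          (2⁻¹ ^ n / d) ^ 2 := by
        intro i
        have h1 := Int.floor_le (x i * (d * 2 ^ n))
        have h2 := (Int.lt_floor_add_one (x i * (d * 2 ^ n))).le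
        have h3 : x i - (⌊x i * (d * 2 ^ n)⌋ : ℝ) / (d * 2 ^ n) =
            (x i * (d * 2 ^ n) - ⌊x i * (d * 2 ^ n)⌋) / (d * 2 ^ n) := by
          field_simp
        rw [Real.dist_eq, sq_abs]
        change (x i - (⌊x i * (d * 2 ^ n)⌋ : ℝ) / (d * 2 ^ n)) ^ 2 ≤ _
        rw [h3]
        have h4 : (2⁻¹ : ℝ) ^ n / d = 1 / (d * 2 ^ n) := by
          rw [inv_pow]
          field_simp
        rw [h4]
        refine pow_le_pow_left₀ (div_nonneg (by linarith) hD.le) ?_ 2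
        gcongr
        linarith
      calc √(∑ i, dist (x i) (pt n (fun i => ⌊x i * (d * 2 ^ n)⌋) i) ^ 2)
          ≤ √(∑ _i : Fin d, (2⁻¹ ^ n / d : ℝ) ^ 2) := by
            exact Real.sqrt_le_sqrt (Finset.sum_le_sum fun i _ => hcoord i)
        _ ≤ √((2⁻¹ ^ n) ^ 2) := by
            apply Real.sqrt_le_sqrt
            simp only [Finset.sum_const, Finset.card_univ, Fintype.card_fin, nsmul_eq_mul]
            rw [div_pow, mul_div_left_comm]
            have : (d : ℝ) / d ^ 2 ≤ 1 := by
              rw [div_le_one (by positivity)]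
              nlinarith
            have hp : (0 : ℝ) ≤ (2⁻¹ ^ n) ^ 2 := by positivity
            nlinarith
        _ = 2⁻¹ ^ n := Real.sqrt_sq (by positivity)
  have hnull : ∀ M : ℕ, P {ω | ∃ x ∈ fractal Φ ω, ∀ i, |x i| ≤ M} = 0 := by
    intro M
    -- An uncovered point forces the ball around a nearby grid point to lie in no set of the
    -- process. There are of order `2^{dn}` grid points, each with probability at most `exp(b - a
    -- n)`.
    have hbound : ∀ n : ℕ, P {ω | ∃ x ∈ fractal Φ ω, ∀ i, |x i| ≤ M} ≤
        ENNReal.ofReal ((2 * M * d + 1) ^ d * Real.exp b *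
          (2 ^ d * Real.exp (-a)) ^ n) := by
      intro n
      let Z := Fintype.piFinset fun _ : Fin d =>
        Finset.Icc (-(M * (d * 2 ^ n) : ℤ)) (M * (d * 2 ^ n))
      have hcard : (Z.card : ℝ) ≤ ((2 * M * d + 1) * 2 ^ n) ^ d := by
        have hc : Z.card = (2 * (M * (d * 2 ^ n)) + 1) ^ d := by
          rw [Fintype.card_piFinset]
          simp only [Int.card_Icc, Finset.prod_const, Finset.card_univ, Fintype.card_fin]
          congr 1
          have : (M * (d * 2 ^ n) + 1 - -(M * (d * 2 ^ n)) : ℤ) =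
            ((2 * (M * (d * 2 ^ n)) + 1 : ℕ) : ℤ) := by push_cast; ring
          rw [this, Int.toNat_natCast]
        rw [hc]
        push_cast
        gcongr
        have : (1 : ℝ) ≤ 2 ^ n := one_le_pow₀ (by norm_num)
        nlinarith
      calc P {ω | ∃ x ∈ fractal Φ ω, ∀ i, |x i| ≤ M}
          ≤ P (⋃ z ∈ Z, {ω | Φ.count {G | closedBall (pt n z) (2⁻¹ ^ n) ⊆ G.carrier} ω = 0}) := by
            refine measure_mono ?_
            rintro ω ⟨x, hx, hxM⟩
            obtain ⟨z, hz, hxz⟩ := happrox M n x hxM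
            refine mem_iUnion₂.2 ⟨z, hz, ?_⟩
            rw [mem_ofPred_eq, PointConfiguration.count_eq_zero_iff]
            intro i hi hsub
            refine hx (mem_iUnion₂.2 ⟨i, hi, hsub hxz⟩)
        _ ≤ ∑ z ∈ Z, P {ω | Φ.count {G | closedBall (pt n z) (2⁻¹ ^ n) ⊆ G.carrier} ω = 0} :=
            measure_biUnion_finset_le _ _
        _ ≤ ∑ _z ∈ Z, ENNReal.ofReal (Real.exp (-(a * n - b))) :=
            Finset.sum_le_sum fun z _ => hΦ.measure_count_eq_zero_le
              (hF.contains _ (isCompact_closedBall _ _)) (hm _ n)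
        _ = ENNReal.ofReal (Z.card * Real.exp (-(a * n - b))) := by
            rw [Finset.sum_const, nsmul_eq_mul, ENNReal.ofReal_mul (by positivity),
              ENNReal.ofReal_natCast]
        _ ≤ _ := by
            apply ENNReal.ofReal_le_ofReal
            calc Z.card * Real.exp (-(a * n - b))
                ≤ ((2 * M * d + 1) * 2 ^ n) ^ d * Real.exp (-(a * n - b)) := by gcongr
              _ = _ := by
                have : Real.exp (-(a * n - b)) = Real.exp b * Real.exp (-a) ^ n := by
                  rw [← Real.exp_nat_mul, ← Real.exp_add]
                  congr 1
                  ring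
                rw [this, mul_pow, mul_pow, ← pow_mul, ← pow_mul, mul_comm n d]
                ring
    have hlt : 2 ^ d * Real.exp (-a) < 1 := by
      have h2 : (2 : ℝ) ^ d = Real.exp (d * Real.log 2) := by
        rw [Real.exp_nat_mul, Real.exp_log (by norm_num)]
      rw [h2, ← Real.exp_add, Real.exp_lt_one_iff]
      linarith
    have ht : Tendsto (fun n : ℕ => ENNReal.ofReal ((2 * M * d + 1) ^ d * Real.exp b *
        (2 ^ d * Real.exp (-a)) ^ n)) atTop (𝓝 0) := by
      rw [← ENNReal.ofReal_zero]
      refine ENNReal.tendsto_ofReal ?_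
      rw [← mul_zero ((2 * M * d + 1) ^ d * Real.exp b)]
      exact (tendsto_pow_atTop_nhds_zero_of_lt_one (by positivity) hlt).const_mul _
    exact le_antisymm (ge_of_tendsto' ht hbound) zero_le
  rw [ae_iff]
  refine measure_mono_null ?_ (measure_iUnion_null hnull)
  intro ω hω
  obtain ⟨x, hx⟩ := nonempty_iff_ne_empty.2 hω
  obtain ⟨M, hM⟩ := exists_nat_ge ‖x‖
  exact mem_iUnion.2 ⟨M, x, hx, fun i => (PiLp.norm_apply_le x i).trans hM⟩

end Covering

/-! ### Non-covering below the threshold by the second moment method. -/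

section SecondMoment

open Set Filter Topology Metric

/-- The second moment method for a random set: if the points of `Y` belong to it with
probability `p` and with correlations bounded by `g`, then it has positive mass with
probability bounded below. -/
theorem measure_univ_le_mul_measure_section_ne_zero {Ω Y : Type} [MeasurableSpace Ω]
    [MeasurableSpace Y] {P : Measure Ω} [IsProbabilityMeasure P] {ν : Measure Y}
    [IsFiniteMeasure ν] {U : Set (Y × Ω)} (hU : MeasurableSet U) {p M : ℝ≥0∞}
    (hp : p ≠ 0) (hp' : p ≠ ∞) {g : Y → Y → ℝ≥0∞} (hone : ∀ x, P (Prod.mk x ⁻¹' U) = p)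
    (htwo : ∀ x y, P (Prod.mk x ⁻¹' U ∩ Prod.mk y ⁻¹' U) ≤ p ^ 2 * g x y)
    (hg : ∀ x, ∫⁻ y, g x y ∂ν ≤ M) :
    ν univ ≤ M * P {ω | ν ((fun x => (x, ω)) ⁻¹' U) ≠ 0} := by
  let Z : Ω → ℝ≥0∞ := fun ω => ν ((fun x => (x, ω)) ⁻¹' U)
  have hZ : Measurable Z := measurable_measure_prodMk_right hU
  have hD : MeasurableSet {ω | Z ω ≠ 0} := hZ (measurableSet_singleton 0).compl
  have hfirst : ∫⁻ ω, Z ω ∂P = p * ν univ := by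
    calc ∫⁻ ω, Z ω ∂P = (ν.prod P) U := (Measure.prod_apply_symm hU).symm
      _ = ∫⁻ x, P (Prod.mk x ⁻¹' U) ∂ν := Measure.prod_apply hU
      _ = _ := by simp [hone]
  have hsecond : ∫⁻ ω, Z ω ^ 2 ∂P ≤ p ^ 2 * (M * ν univ) := by
    let W : Set ((Y × Y) × Ω) := {q | (q.1.1, q.2) ∈ U} ∩ {q | (q.1.2, q.2) ∈ U}
    have hW : MeasurableSet W :=
      (((measurable_fst.comp measurable_fst).prodMk measurable_snd) hU).inter
        (((measurable_snd.comp measurable_fst).prodMk measurable_snd) hU)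
    calc ∫⁻ ω, Z ω ^ 2 ∂P = ∫⁻ ω, (ν.prod ν) ((fun x => (x, ω)) ⁻¹' W) ∂P := by
          refine lintegral_congr fun ω => ?_
          have : (fun x => (x, ω)) ⁻¹' W =
              ((fun x => (x, ω)) ⁻¹' U) ×ˢ ((fun x => (x, ω)) ⁻¹' U) := rfl
          rw [this, Measure.prod_prod, sq]
      _ = ((ν.prod ν).prod P) W := (Measure.prod_apply_symm hW).symm
      _ = ∫⁻ q, P (Prod.mk q ⁻¹' W) ∂(ν.prod ν) := Measure.prod_apply hW
      _ = ∫⁻ x, ∫⁻ y, P (Prod.mk (x, y) ⁻¹' W) ∂ν ∂ν :=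
          lintegral_prod _ (measurable_measure_prodMk_left hW).aemeasurable
      _ ≤ ∫⁻ x, ∫⁻ y, p ^ 2 * g x y ∂ν ∂ν :=
          lintegral_mono fun x => lintegral_mono fun y => htwo x y
      _ = ∫⁻ x, p ^ 2 * ∫⁻ y, g x y ∂ν ∂ν := by
          refine lintegral_congr fun x => lintegral_const_mul' _ _ (by simp [hp'])
      _ ≤ ∫⁻ _x, p ^ 2 * M ∂ν := lintegral_mono fun x => by gcongr; exact hg x
      _ = _ := by rw [lintegral_const, mul_assoc]
  -- Cauchy–Schwarz for `Z` against the indicator of its support.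
  have hcs : (∫⁻ ω, Z ω ∂P) ^ 2 ≤ (∫⁻ ω, Z ω ^ 2 ∂P) * P {ω | Z ω ≠ 0} := by
    have h := ENNReal.lintegral_mul_le_Lp_mul_Lq P Real.HolderConjugate.two_two
      hZ.aemeasurable (g := {ω | Z ω ≠ 0}.indicator 1)
      (measurable_one.indicator hD).aemeasurable
    have hprod : Z * {ω | Z ω ≠ 0}.indicator 1 = Z := by
      ext ω
      by_cases hω : Z ω = 0 <;> simp [hω]
    have hind : ∀ ω, ({ω | Z ω ≠ 0}.indicator (1 : Ω → ℝ≥0∞) ω) ^ (2 : ℝ) =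
        {ω | Z ω ≠ 0}.indicator 1 ω := by
      intro ω
      by_cases hω : Z ω = 0 <;> simp [hω]
    rw [hprod] at h
    simp only [hind, lintegral_indicator_one hD] at h
    calc (∫⁻ ω, Z ω ∂P) ^ 2
        ≤ ((∫⁻ ω, Z ω ^ (2 : ℝ) ∂P) ^ (1 / 2 : ℝ) * P {ω | Z ω ≠ 0} ^ (1 / 2 : ℝ)) ^ 2 := by
          gcongr
      _ = _ := by
          rw [mul_pow, ← ENNReal.rpow_natCast, ← ENNReal.rpow_natCast, ← ENNReal.rpow_mul,
            ← ENNReal.rpow_mul]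
          simp
  by_cases hV : ν univ = 0
  · simp [hV]
  rw [hfirst] at hcs
  have hfinal : p ^ 2 * ν univ * ν univ ≤
      p ^ 2 * ν univ * (M * P {ω | Z ω ≠ 0}) :=
    calc p ^ 2 * ν univ * ν univ = (p * ν univ) ^ 2 := by ring
      _ ≤ (∫⁻ ω, Z ω ^ 2 ∂P) * P {ω | Z ω ≠ 0} := hcs
      _ ≤ p ^ 2 * (M * ν univ) * P {ω | Z ω ≠ 0} := by gcongr
      _ = _ := by ring
  refine (ENNReal.mul_le_mul_iff_right ?_ ?_).1 hfinal
  · simp [hp, hV]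
  · exact ENNReal.mul_ne_top (by simp [hp']) (measure_ne_top _ _)

variable {d : ℕ}

/-- The sets whose distance to `x` is smaller than `ε` times their diameter. -/
def relThickening (ε : ℝ≥0∞) (x : EuclideanSpace ℝ (Fin d)) : Set (SmallSet d) :=
  {G | infEDist x G.carrier < ε * ediam G.carrier}

/-- The factor `3` counts one diameter for the set itself and at most one for the gap at either end.
This is what decorrelates distant points: only the shells with `2^{-k}` at least a third of their
distance affect both. -/
theorem dist_le_of_mem_relThickening {ε : ℝ≥0∞} (hε : ε ≤ 1) {x y : EuclideanSpace ℝ (Fin d)}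
    {k : ℕ} {G : SmallSet d} (hx : G ∈ relThickening ε x) (hy : G ∈ relThickening ε y)
    (hk : G ∈ diamShell d k) : y ∈ closedBall x (3 * 2⁻¹ ^ k) := by
  obtain ⟨a, ha, hxa⟩ := infEDist_lt_iff.1 hx
  obtain ⟨b, hb, hyb⟩ := infEDist_lt_iff.1 hy
  have hmul : ε * ediam G.carrier ≤ 2⁻¹ ^ k := by
    calc ε * ediam G.carrier ≤ 1 * 2⁻¹ ^ k := mul_le_mul' hε hk.2.le
      _ = _ := one_mul _
  have h : edist y x ≤ ENNReal.ofReal (3 * 2⁻¹ ^ k) := by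
    calc edist y x ≤ edist y b + edist b a + edist a x := edist_triangle4 _ _ _ _
      _ ≤ 2⁻¹ ^ k + 2⁻¹ ^ k + 2⁻¹ ^ k := by
          gcongr
          · exact hyb.le.trans hmul
          · exact (edist_le_ediam_of_mem hb ha).trans hk.2.le
          · rw [edist_comm]
            exact hxa.le.trans hmul
      _ = _ := by
          rw [ENNReal.ofReal_mul (by norm_num), ENNReal.ofReal_pow (by norm_num),
            ENNReal.ofReal_inv_of_pos (by norm_num)]
          simp
          ring
  rwa [mem_closedBall, ← edist_le_ofReal (by positivity)]

/-- The cardinality is at most one plus the largest element, whose term alone dominates. The sum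
replaces a correlation depending on the distance of two points by a combination of indicators of
balls, which is easy to integrate. -/
theorem exp_card_mul_le {h : ℝ} (hh : 0 ≤ h) (s : Finset ℕ) :
    Real.exp (s.card * h) ≤ 1 + ∑ k ∈ s, Real.exp (h * (k + 1)) := by
  rcases s.eq_empty_or_nonempty with rfl | hs
  · simp
  · have hmax := s.max'_mem hs
    have hcard : s.card ≤ s.max' hs + 1 := by
      calc s.card ≤ (Finset.range (s.max' hs + 1)).card :=
            Finset.card_le_card fun k hk => by
              rw [Finset.mem_range]
              exact Nat.lt_succ_of_le (s.le_max' k hk)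
        _ = _ := Finset.card_range _
    have hcard' : (s.card : ℝ) ≤ s.max' hs + 1 := by exact_mod_cast hcard
    calc Real.exp (s.card * h) ≤ Real.exp (h * (s.max' hs + 1)) := by
          rw [mul_comm]
          gcongr
      _ ≤ ∑ k ∈ s, Real.exp (h * (k + 1)) :=
          Finset.single_le_sum (f := fun k : ℕ => Real.exp (h * (k + 1)))
            (fun _ _ => (Real.exp_pos _).le) hmax
      _ ≤ _ := by linarith

variable [MeasurableSpace (SmallSet d)]

theorem measurableSet_relThickening_uncurry (hF : IsSuitableSigmaAlgebra d) (ε : ℝ≥0∞) :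
    MeasurableSet {p : EuclideanSpace ℝ (Fin d) × SmallSet d | p.2 ∈ relThickening ε p.1} :=
  measurableSet_lt hF.measurable_infEDist_uncurry
    ((hF.measurable_ediam.comp measurable_snd).const_mul ε)

theorem measurableSet_relThickening (hF : IsSuitableSigmaAlgebra d) (ε : ℝ≥0∞)
    (x : EuclideanSpace ℝ (Fin d)) : MeasurableSet (relThickening (d := d) ε x) :=
  measurable_prodMk_left (x := x) (measurableSet_relThickening_uncurry hF ε)

/-- If the mass of the sets of a given dyadic size near a given point is less than `d log 2`, then
with positive probability the closures of the sets of the process do not cover the space. -/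
theorem not_ae_forall_mem_closure_of_exp_lt (hF : IsSuitableSigmaAlgebra d)
    {m : Measure (SmallSet d)} {ε : ℝ≥0∞} {h : ℝ} (hε0 : ε ≠ 0) (hε : ε ≤ 1) (hh : 0 ≤ h)
    (hlt : Real.exp h < 2 ^ d)
    (hshell : ∀ x k, m (relThickening ε x ∩ diamShell d k) = ENNReal.ofReal h)
    (hpoint : ∀ᵐ G ∂m, G.carrier = ∅ ∨ ediam G.carrier ≠ 0)
    {Ω : Type} [MeasurableSpace Ω] {P : Measure Ω} [IsProbabilityMeasure P]
    {Φ : PointConfiguration Ω (SmallSet d)} (hΦ : IsPoissonProcess P Φ m) :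
    ¬ ∀ᵐ ω ∂P, ∀ x, ∃ i : ℕ, (i : ℕ∞) < Φ.number ω ∧ x ∈ closure (Φ.point i ω).carrier := by
  classical
  intro hcover
  let T : ℕ → Set (EuclideanSpace ℝ (Fin d) × SmallSet d) := fun n =>
    {p | p.2 ∈ relThickening ε p.1} ∩ {p | 2⁻¹ ^ n ≤ ediam p.2.carrier}
  have hT : ∀ n, MeasurableSet (T n) := fun n =>
    (measurableSet_relThickening_uncurry hF ε).inter
      (measurable_snd (hF.measurable_ediam measurableSet_Ici))
  have hTx : ∀ n x, MeasurableSet (Prod.mk x ⁻¹' T n) := fun n x => measurable_prodMk_left (hT n)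
  have hTunion : ∀ n x, Prod.mk x ⁻¹' T n =
      ⋃ k ∈ Finset.range n, relThickening ε x ∩ diamShell d k := by
    intro n x
    rw [← inter_iUnion₂, iUnion_diamShell_lt]
    rfl
  have hdisj : ∀ (x : EuclideanSpace ℝ (Fin d)) (s : Set ℕ),
      s.PairwiseDisjoint fun k => relThickening ε x ∩ diamShell d k := fun x s i _ j _ hij =>
    (pairwise_disjoint_diamShell hij).mono inter_subset_right inter_subset_right
  have hmeas : ∀ x k, MeasurableSet (relThickening ε x ∩ diamShell d k) := fun x k =>
    (measurableSet_relThickening hF ε x).inter (measurableSet_diamShell hF k)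
  have hmT : ∀ n x, m (Prod.mk x ⁻¹' T n) = ENNReal.ofReal (n * h) := by
    intro n x
    rw [hTunion, measure_biUnion_finset (hdisj x _) fun k _ => hmeas x k]
    simp [hshell, ENNReal.ofReal_mul]
  have hmTT : ∀ n x y, m (Prod.mk x ⁻¹' T n ∩ Prod.mk y ⁻¹' T n) ≤
      ENNReal.ofReal (((Finset.range n).filter
        fun k => y ∈ closedBall x (3 * 2⁻¹ ^ k)).card * h) := by
    intro n x y
    calc m (Prod.mk x ⁻¹' T n ∩ Prod.mk y ⁻¹' T n)
        ≤ m (⋃ k ∈ (Finset.range n).filter fun k => y ∈ closedBall x (3 * 2⁻¹ ^ k),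
            relThickening ε x ∩ diamShell d k) := by
          refine measure_mono ?_
          rintro G ⟨hx, hy⟩
          have hx' := hx
          rw [hTunion] at hx'
          obtain ⟨k, hk, hGx, hGk⟩ := mem_iUnion₂.1 hx'
          refine mem_iUnion₂.2 ⟨k, ?_, hGx, hGk⟩
          exact Finset.mem_filter.2 ⟨hk, dist_le_of_mem_relThickening hε hGx hy.1 hGk⟩
      _ = _ := by
          rw [measure_biUnion_finset (hdisj x _) fun k _ => hmeas x k]
          simp [hshell, ENNReal.ofReal_mul]
  let U : ℕ → Set (EuclideanSpace ℝ (Fin d) × Ω) := fun n =>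
    {q | Φ.count (Prod.mk q.1 ⁻¹' T n) q.2 = 0}
  have hU : ∀ n, MeasurableSet (U n) := fun n =>
    PointConfiguration.measurableSet_count_eq_zero hΦ.measurable_number hΦ.measurable_point (hT n)
  let B : Set (EuclideanSpace ℝ (Fin d)) := closedBall 0 1
  let ν : Measure (EuclideanSpace ℝ (Fin d)) := volume.restrict B
  have hνfin : IsFiniteMeasure ν := ⟨by
    rw [Measure.restrict_apply_univ]
    exact measure_closedBall_lt_top⟩
  have hV0 : ν univ ≠ 0 := by
    rw [Measure.restrict_apply_univ]
    exact (measure_closedBall_pos _ _ one_pos).ne'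
  -- Ratio of the geometric series bounding the correlations: shell `k` costs a factor `e^{hk}`,
  -- while a ball of radius `3 · 2^{-k}` has volume of order `2^{-dk}`.
  let q : ℝ := Real.exp h * 2⁻¹ ^ d
  have hq0 : 0 ≤ q := by positivity
  have hq1 : q < 1 := by
    have : (2 : ℝ) ^ d * 2⁻¹ ^ d = 1 := by rw [← mul_pow]; norm_num
    calc q < 2 ^ d * 2⁻¹ ^ d := mul_lt_mul_of_pos_right hlt (by positivity)
      _ = 1 := this
  let M : ℝ≥0∞ := ν univ + ENNReal.ofReal (Real.exp h * 3 ^ d * (1 - q)⁻¹) *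
    volume (ball (0 : EuclideanSpace ℝ (Fin d)) 1)
  have hMtop : M ≠ ∞ := by
    refine ENNReal.add_ne_top.2 ⟨measure_ne_top _ _, ENNReal.mul_ne_top ENNReal.ofReal_ne_top ?_⟩
    exact measure_ball_lt_top.ne
  let g : ℕ → EuclideanSpace ℝ (Fin d) → EuclideanSpace ℝ (Fin d) → ℝ≥0∞ := fun n x y =>
    1 + ∑ k ∈ Finset.range n, ENNReal.ofReal (Real.exp (h * (k + 1))) *
      (closedBall x (3 * 2⁻¹ ^ k)).indicator 1 y
  have hg : ∀ n x, ∫⁻ y, g n x y ∂ν ≤ M := by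
    intro n x
    have hind : ∀ k : ℕ, Measurable ((closedBall x (3 * 2⁻¹ ^ k)).indicator
        (1 : EuclideanSpace ℝ (Fin d) → ℝ≥0∞)) := fun k =>
      measurable_one.indicator measurableSet_closedBall
    calc ∫⁻ y, g n x y ∂ν
        = ν univ + ∑ k ∈ Finset.range n, ENNReal.ofReal (Real.exp (h * (k + 1))) *
            ν (closedBall x (3 * 2⁻¹ ^ k)) := by
          simp only [g]
          rw [lintegral_add_left measurable_const, lintegral_finsetSum]
          · simp only [lintegral_const_mul _ (hind _),
              lintegral_indicator_one measurableSet_closedBall, lintegral_const, one_mul]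
          · exact fun k _ => (hind k).const_mul _
      _ ≤ ν univ + ∑ k ∈ Finset.range n, ENNReal.ofReal (Real.exp h * 3 ^ d * q ^ k) *
            volume (ball (0 : EuclideanSpace ℝ (Fin d)) 1) := by
          gcongr ν univ + ∑ k ∈ Finset.range n, ?_ with k hk
          calc ENNReal.ofReal (Real.exp (h * (k + 1))) * ν (closedBall x (3 * 2⁻¹ ^ k))
              ≤ ENNReal.ofReal (Real.exp (h * (k + 1))) *
                  volume (closedBall x (3 * 2⁻¹ ^ k)) := by
                gcongr
                exact Measure.restrict_le_self
            _ = _ := by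
                rw [Measure.addHaar_closedBall _ _ (by positivity), ← mul_assoc,
                  ← ENNReal.ofReal_mul (by positivity), finrank_euclideanSpace_fin]
                congr 2
                have : Real.exp (h * (k + 1)) = Real.exp h * Real.exp h ^ k := by
                  rw [← Real.exp_nat_mul, ← Real.exp_add]
                  congr 1
                  ring
                rw [this, mul_pow, mul_pow, ← pow_mul, ← pow_mul, mul_comm k d]
                ring
      _ ≤ M := by
          simp only [M]
          rw [← Finset.sum_mul, ← ENNReal.ofReal_sum_of_nonneg fun k _ => by positivity,
            ← Finset.mul_sum]
          gcongr
          rw [← tsum_geometric_of_lt_one hq0 hq1]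
          exact (summable_geometric_of_lt_one hq0 hq1).sum_le_tsum _ fun _ _ => by positivity
  have hprob : ∀ n, ν univ ≤ M * P {ω | ν ((fun x => (x, ω)) ⁻¹' U n) ≠ 0} := by
    intro n
    refine measure_univ_le_mul_measure_section_ne_zero (hU n)
      (p := ENNReal.ofReal (Real.exp (-(n * h)))) (g := g n) (by simp [Real.exp_pos])
      ENNReal.ofReal_ne_top (fun x => ?_) (fun x y => ?_) (hg n)
    · have := hΦ.measure_count_eq_zero (hTx n x) (by rw [hmT]; exact ENNReal.ofReal_ne_top)
      rw [hmT, ENNReal.toReal_ofReal (by positivity)] at this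
      exact this
    · let N : ℝ := ((Finset.range n).filter fun k => y ∈ closedBall x (3 * 2⁻¹ ^ k)).card
      -- Inclusion–exclusion: each of the two families has mass `n h`, and by `hmTT` they share at
      -- most `N h`.
      have hle : ENNReal.ofReal (n * h + n * h - N * h) ≤
          m (Prod.mk x ⁻¹' T n ∪ Prod.mk y ⁻¹' T n) := by
        have hN : 0 ≤ N * h := by positivity
        rw [ENNReal.ofReal_sub _ hN, tsub_le_iff_right,
          ENNReal.ofReal_add (by positivity) (by positivity), ← hmT n x]
        nth_rewrite 2 [hmT n x]
        rw [← hmT n y, ← measure_union_add_inter _ (hTx n y)]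
        gcongr
        exact hmTT n x y
      calc P (Prod.mk x ⁻¹' U n ∩ Prod.mk y ⁻¹' U n)
          ≤ P {ω | Φ.count (Prod.mk x ⁻¹' T n ∪ Prod.mk y ⁻¹' T n) ω = 0} := by
            refine measure_mono ?_
            rintro ω ⟨hx, hy⟩
            have hx' := (Φ.count_eq_zero_iff _ _).1 hx
            have hy' := (Φ.count_eq_zero_iff _ _).1 hy
            exact (Φ.count_eq_zero_iff _ _).2 fun i hi hmem =>
              hmem.elim (hx' i hi) (hy' i hi)
        _ ≤ ENNReal.ofReal (Real.exp (-(n * h + n * h - N * h))) :=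
            hΦ.measure_count_eq_zero_le ((hTx n x).union (hTx n y)) hle
        _ = ENNReal.ofReal (Real.exp (-(n * h))) ^ 2 * ENNReal.ofReal (Real.exp (N * h)) := by
            rw [← ENNReal.ofReal_pow (Real.exp_pos _).le, ← ENNReal.ofReal_mul (by positivity),
              ← Real.exp_nat_mul, ← Real.exp_add]
            congr 2
            push_cast
            ring
        _ ≤ ENNReal.ofReal (Real.exp (-(n * h))) ^ 2 * g n x y := by
            gcongr
            refine (ENNReal.ofReal_le_ofReal (exp_card_mul_le hh _)).trans ?_
            rw [ENNReal.ofReal_add zero_le_one (Finset.sum_nonneg fun _ _ => (Real.exp_pos _).le),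
              ENNReal.ofReal_one, ENNReal.ofReal_sum_of_nonneg fun _ _ => (Real.exp_pos _).le,
              Finset.sum_filter]
            simp only [g]
            gcongr with k hk
            split_ifs with hk
            · rw [indicator_of_mem hk, Pi.one_apply, mul_one]
            · exact zero_le
  have hUanti : ∀ ω, Antitone fun n => (fun x => (x, ω)) ⁻¹' U n := by
    intro ω i j hij x hx
    have hle : (2⁻¹ : ℝ≥0∞) ^ j ≤ 2⁻¹ ^ i := pow_le_pow_right_of_le_one' (by simp) hij
    have hsub : Prod.mk x ⁻¹' T i ⊆ Prod.mk x ⁻¹' T j := fun G hG => ⟨hG.1, hle.trans hG.2⟩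
    exact Φ.count_eq_zero_mono hsub hx
  let D : ℕ → Set Ω := fun n => {ω | ν ((fun x => (x, ω)) ⁻¹' U n) ≠ 0}
  have hDmeas : ∀ n, MeasurableSet (D n) := fun n =>
    (measurable_measure_prodMk_right (hU n)) (measurableSet_singleton 0).compl
  have hDanti : Antitone D := by
    intro i j hij ω hω h0
    exact hω (measure_mono_null (hUanti ω hij) h0)
  -- The bound `M` does not depend on `n`, so the lower bound on the probabilities survives the
  -- decreasing limit.
  have hDpos : P (⋂ n, D n) ≠ 0 := by
    intro h0
    have ht := tendsto_measure_iInter_atTop (μ := P) (s := D)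
      (fun n => (hDmeas n).nullMeasurableSet) hDanti ⟨0, measure_ne_top _ _⟩
    rw [h0] at ht
    have ht' := ENNReal.Tendsto.const_mul ht (.inr hMtop)
    rw [mul_zero] at ht'
    exact hV0 (le_antisymm (ge_of_tendsto' ht' hprob) zero_le)
  have hnull : MeasurableSet {G : SmallSet d | G.carrier ≠ ∅ ∧ ediam G.carrier = 0} := by
    have := (hF.measurableSet_hits_isOpen isOpen_univ).inter
      (hF.measurable_ediam (measurableSet_singleton 0))
    simp only [inter_univ, nonempty_iff_ne_empty] at this
    exact this
  -- Nonempty sets of diameter zero belong to no relative thickening, so they have to be excluded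
  -- separately.
  have hpt : ∀ᵐ ω ∂P, Φ.count {G | G.carrier ≠ ∅ ∧ ediam G.carrier = 0} ω = 0 := by
    have hzero : m {G | G.carrier ≠ ∅ ∧ ediam G.carrier = 0} = 0 := by
      simpa [ae_iff] using hpoint
    have := hΦ.measure_count_eq_zero hnull (by simp [hzero])
    rw [hzero] at this
    have hmeasN : NullMeasurableSet
        {ω | Φ.count {G | G.carrier ≠ ∅ ∧ ediam G.carrier = 0} ω = 0} P :=
      (hΦ.aemeasurable_count hnull).nullMeasurableSet_preimage (measurableSet_singleton 0)
    exact (prob_compl_eq_zero_iff₀ hmeasN).2 (by simpa using this)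
  refine hDpos (measure_mono_null ?_ (ae_iff.1 (hcover.and hpt)))
  rintro ω hω ⟨hωc, hωp⟩
  have hclosed : ∀ n, IsClosed ((fun x => (x, ω)) ⁻¹' U n) := by
    intro n
    have : (fun x => (x, ω)) ⁻¹' U n = ⋂ (i : ℕ) (_ : (i : ℕ∞) < Φ.number ω)
        (_ : 2⁻¹ ^ n ≤ ediam (Φ.point i ω).carrier),
          {x | ε * ediam (Φ.point i ω).carrier ≤ infEDist x (Φ.point i ω).carrier} := by
      ext x
      simp only [U, T, mem_preimage, mem_ofPred_eq, PointConfiguration.count_eq_zero_iff,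
        mem_inter_iff, mem_iInter, relThickening, not_and, not_le, ← not_lt (b := ε * _)]
      exact forall₂_congr fun i hi => by rw [← not_lt]; tauto
    rw [this]
    exact isClosed_iInter fun i => isClosed_iInter fun _ => isClosed_iInter fun _ =>
      isClosed_le continuous_const continuous_infEDist
  -- Positive volume makes each stage nonempty, and the strict inequality in `relThickening` makes
  -- the uncovered regions closed, so Cantor's intersection theorem applies.
  have hne : (⋂ n, B ∩ (fun x => (x, ω)) ⁻¹' U n).Nonempty := by
    refine IsCompact.nonempty_iInter_of_sequence_nonempty_isCompact_isClosed _ ?_ ?_ ?_ ?_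
    · exact fun n => inter_subset_inter_right _ (hUanti ω n.le_succ)
    · intro n
      have := mem_iInter.1 hω n
      by_contra hempty
      refine this ?_
      rw [Measure.restrict_apply (hclosed n).measurableSet, inter_comm,
        not_nonempty_iff_eq_empty.1 hempty, measure_empty]
    · exact (isCompact_closedBall _ _).inter_right (hclosed 0)
    · exact fun n => isClosed_closedBall.inter (hclosed n)
  obtain ⟨x, hx⟩ := hne
  obtain ⟨i, hi, hxi⟩ := hωc x
  have hdiam : ediam (Φ.point i ω).carrier ≠ 0 := fun h0 =>
    (Φ.count_eq_zero_iff _ _).1 hωp i hi ⟨(closure_nonempty_iff.1 ⟨x, hxi⟩).ne_empty, h0⟩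
  have ht : Tendsto (fun n : ℕ => (2⁻¹ : ℝ≥0∞) ^ n) atTop (𝓝 0) :=
    ENNReal.tendsto_pow_atTop_nhds_zero_of_lt_one (by simp)
  obtain ⟨n, hn⟩ := (ht.eventually_lt_const (pos_iff_ne_zero.2 hdiam)).exists
  refine (Φ.count_eq_zero_iff _ _).1 (mem_iInter.1 hx n).2 i hi ⟨?_, hn.le⟩
  rw [mem_ofPred_eq, relThickening, mem_ofPred_eq, mem_closure_iff_infEDist_zero.1 hxi]
  exact pos_iff_ne_zero.2 (mul_ne_zero hε0 hdiam)

end SecondMoment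

/-! ### Mass per scale of the thickened sets, and its limit as the thickening shrinks. -/

section ThickenedDensity

open Set Filter Topology Metric

variable {d : ℕ} [MeasurableSpace (SmallSet d)] {μ : Measure (SmallSet d)}

theorem measure_relThickening_inter_diamShell_zero_lt_top (h1 : LocallyFiniteModel μ) {ε : ℝ≥0∞}
    (hε : ε ≤ 1) : μ (relThickening ε 0 ∩ diamShell d 0) < ∞ := by
  refine (measure_mono (inter_subset_inter_left _ fun G hG => ?_)).trans_lt
    (h1.measure_diamShell_lt_top (isBounded_closedBall (x := 0) (r := 1)) 0)
  obtain ⟨a, ha, hxa⟩ := infEDist_lt_iff.1 hG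
  refine ⟨a, ha, ?_⟩
  have : edist a 0 ≤ ENNReal.ofReal 1 := by
    rw [edist_comm, ENNReal.ofReal_one]
    exact hxa.le.trans (mul_le_one' hε G.ediam_lt_one.le)
  rwa [mem_closedBall, ← edist_le_ofReal zero_le_one]

/-- Thickening proportionally to the diameter commutes with scaling: distance and diameter pick up
the same factor. -/
theorem measure_relThickening_inter_diamShell (hF : IsSuitableSigmaAlgebra d)
    (hscale : SemiScaleInvariant μ) (htrans : TranslationInvariant μ)
    (h1 : LocallyFiniteModel μ) {ε : ℝ≥0∞} (hε : ε ≤ 1) (x : EuclideanSpace ℝ (Fin d)) (k : ℕ) :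
    μ (relThickening ε x ∩ diamShell d k) = μ (relThickening ε 0 ∩ diamShell d 0) := by
  have hm : ∀ x k, MeasurableSet (relThickening ε x ∩ diamShell d k) := fun x k =>
    (measurableSet_relThickening hF ε x).inter (measurableSet_diamShell hF k)
  rw [← htrans.measure_preimage_translate x (hm x k)]
  have hset : SmallSet.translate x ⁻¹' (relThickening ε x ∩ diamShell d k) =
      relThickening ε 0 ∩ diamShell d k := by
    ext G
    have := SmallSet.infEDist_translate x 0 G
    rw [add_zero] at this
    simp [relThickening, diamShell, SmallSet.ediam_translate, this]
  rw [hset]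
  have h := hscale.measure_diamShell (fun A => infEDist 0 A < ε * ediam A) k (hm 0 0)
    (measure_relThickening_inter_diamShell_zero_lt_top h1 hε)
  refine Eq.trans ?_ h
  congr 2
  ext G
  have h2 : (2 ^ k : ℝ) ≠ 0 := by positivity
  have hn : ((‖(2 : ℝ) ^ k‖₊ : ℝ≥0) : ℝ≥0∞) ≠ 0 := by simp
  have h3 := infEDist_smul₀ h2 G.carrier 0
  rw [smul_zero, ENNReal.smul_def, smul_eq_mul] at h3
  rw [relThickening, mem_ofPred_eq, mem_ofPred_eq, h3, ediam_smul₀, ENNReal.smul_def, smul_eq_mul,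
    mul_left_comm, ENNReal.mul_lt_mul_iff_right hn ENNReal.coe_ne_top]

/-- Within the shell the thickenings decrease to the event that the origin lies in the closure,
which differs from lying in the set only by the null event that it lies on the boundary. -/
theorem tendsto_measure_relThickening [SFinite μ] (hF : IsSuitableSigmaAlgebra d)
    (htrans : TranslationInvariant μ) (h1 : LocallyFiniteModel μ) (h2 : NullBoundaries μ) :
    Tendsto (fun j : ℕ => μ (relThickening (2⁻¹ ^ j) 0 ∩ diamShell d 0)) atTop
      (𝓝 (scaleDensity μ)) := by
  have hanti : Antitone fun j : ℕ => relThickening (2⁻¹ ^ j) 0 ∩ diamShell d 0 := by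
    intro i j hij
    refine inter_subset_inter_left _ fun G hG => ?_
    refine lt_of_lt_of_le (show infEDist 0 G.carrier < 2⁻¹ ^ j * ediam G.carrier from hG) ?_
    gcongr ?_ * _
    exact pow_le_pow_right_of_le_one' (by simp) hij
  convert! tendsto_measure_iInter_atTop (μ := μ) (fun j =>
    ((measurableSet_relThickening hF (2⁻¹ ^ j) 0).inter
      (measurableSet_diamShell hF 0)).nullMeasurableSet) hanti
    ⟨0, by simpa using (measure_relThickening_inter_diamShell_zero_lt_top h1 le_rfl).ne⟩ using 2
  refine measure_congr ?_
  have hfr : ∀ᵐ G ∂μ, (0 : EuclideanSpace ℝ (Fin d)) ∉ frontier G.carrier := by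
    simpa [ae_iff] using measure_zero_mem_frontier hF htrans h2
  filter_upwards [hfr] with G hG
  simp only [eq_iff_iff]
  constructor
  · rintro ⟨h0, hs⟩
    refine mem_iInter.2 fun j => ⟨?_, hs⟩
    have hpos : ediam G.carrier ≠ 0 := fun h => by
      have := hs.1
      simp [h] at this
    rw [relThickening, mem_ofPred_eq, infEDist_zero_of_mem (s := G.carrier) h0]
    exact pos_iff_ne_zero.2 (mul_ne_zero (by simp) hpos)
  · intro h
    have hs := (mem_iInter.1 h 0).2
    refine ⟨?_, hs⟩
    have hcl : (0 : EuclideanSpace ℝ (Fin d)) ∈ closure G.carrier := by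
      rw [mem_closure_iff_infEDist_zero]
      have ht : Tendsto (fun m : ℕ => (2⁻¹ : ℝ≥0∞) ^ m) atTop (𝓝 0) :=
        ENNReal.tendsto_pow_atTop_nhds_zero_of_lt_one (by simp)
      refine le_antisymm (ge_of_tendsto' ht fun j => ?_) zero_le
      calc infEDist 0 G.carrier ≤ 2⁻¹ ^ j * ediam G.carrier := (mem_iInter.1 h j).1.le
        _ ≤ 2⁻¹ ^ j * 1 := by gcongr; exact G.ediam_lt_one.le
        _ = _ := mul_one _
    by_contra hnot
    exact hG ⟨hcl, fun hi => hnot (interior_subset (s := G.carrier) hi)⟩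

end ThickenedDensity

/-! ### Laws of extended counts, their generating functions, and enumeration of random index sets.
-/

section CountingLaws

open Set Filter Topology
open scoped BoundedContinuousFunction

/-- The weight `2^{-n}`, with the convention `2^{-∞} = 0`. -/
noncomputable def halfPow (n : ℕ∞) : ℝ :=
  if n = ⊤ then 0 else 2⁻¹ ^ n.toNat

theorem halfPow_top : halfPow ⊤ = 0 := if_pos rfl

theorem halfPow_natCast (n : ℕ) : halfPow n = 2⁻¹ ^ n := by
  simp [halfPow]

theorem halfPow_mem_unitInterval (n : ℕ∞) : halfPow n ∈ unitInterval := by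
  unfold halfPow
  split_ifs
  · simp
  · exact ⟨by positivity, pow_le_one₀ (by norm_num) (by norm_num)⟩

theorem halfPow_injective : Function.Injective halfPow := by
  intro a b hab
  induction a with
  | top =>
    induction b with
    | top => rfl
    | coe b =>
      rw [halfPow_top, halfPow_natCast] at hab
      exact absurd hab.symm (by positivity)
  | coe a =>
    induction b with
    | top =>
      rw [halfPow_top, halfPow_natCast] at hab
      exact absurd hab (by positivity)
    | coe b =>
      rw [halfPow_natCast, halfPow_natCast] at hab
      exact congrArg _ (pow_right_injective₀ (by norm_num) (by norm_num) hab)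

/-- If `T` is finite the cardinalities stabilize, otherwise they tend to infinity. The convention
`2^{-∞} = 0` unites the two cases. -/
theorem tendsto_pow_card_halfPow_encard {α : Type*} {T : Set α} {F : ℕ → Finset α}
    (hF : ∀ M, (F M : Set α) ⊆ T) (hT : ∀ t ∈ T, ∀ᶠ M in atTop, t ∈ F M) :
    Tendsto (fun M => (2⁻¹ : ℝ) ^ (F M).card) atTop (𝓝 (halfPow T.encard)) := by
  have hsub : ∀ s : Finset α, (s : Set α) ⊆ T → ∀ᶠ M in atTop, s ⊆ F M := by
    intro s hs
    have := (Finset.eventually_all s).2 fun t ht => hT t (hs ht)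
    filter_upwards [this] with M hM using hM
  by_cases hfin : T.Finite
  · rw [hfin.encard_eq_coe_toFinset_card, halfPow_natCast]
    refine tendsto_const_nhds.congr' ?_
    filter_upwards [hsub hfin.toFinset (by simp)] with M hM
    congr 2
    exact Finset.Subset.antisymm hM fun t ht => by simpa using hF M ht
  · rw [Set.Infinite.encard_eq hfin, halfPow_top]
    have hcard : Tendsto (fun M => (F M).card) atTop atTop := by
      refine tendsto_atTop.2 fun n => ?_
      obtain ⟨s, hs, hcard⟩ := Set.Infinite.exists_subset_card_eq hfin n
      filter_upwards [hsub s hs] with M hM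
      exact hcard ▸ Finset.card_le_card hM
    exact (tendsto_pow_atTop_nhds_zero_of_lt_one (by norm_num) (by norm_num)).comp hcard

/-- A law on the cube is determined by its moments. -/
theorem measure_unitInterval_ext_of_moments {k : ℕ} {Q Q' : Measure (Fin k → unitInterval)}
    [IsFiniteMeasure Q] [IsFiniteMeasure Q']
    (h : ∀ a : Fin k → ℕ, ∫ x, ∏ i, (x i : ℝ) ^ a i ∂Q = ∫ x, ∏ i, (x i : ℝ) ^ a i ∂Q') :
    Q = Q' := by
  let coord : Fin k → (Fin k → unitInterval) →ᵇ ℝ := fun i =>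
    BoundedContinuousFunction.mkOfCompact ⟨fun x => (x i : ℝ), by fun_prop⟩
  -- The polynomials in the coordinates separate points, so integrals over this algebra determine a
  -- finite measure (Stone–Weierstrass).
  let A : StarSubalgebra ℝ ((Fin k → unitInterval) →ᵇ ℝ) :=
    { (MvPolynomial.aeval (R := ℝ) coord).range with
      star_mem' := fun {f} hf => by
        have : star f = f := by ext; simp
        rwa [this] }
  refine ext_of_forall_mem_subalgebra_integral_eq_of_polish (𝕜 := ℝ) (A := A) ?_ ?_
  · intro x y hxy
    obtain ⟨i, hi⟩ := Function.ne_iff.1 hxy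
    refine ⟨coord i, ⟨BoundedContinuousFunction.toContinuousMapStarₐ ℝ (coord i), ?_, rfl⟩, ?_⟩
    · exact StarSubalgebra.mem_map.2 ⟨coord i, ⟨MvPolynomial.X i, by simp⟩, rfl⟩
    · exact fun he => hi (Subtype.ext he)
  · rintro g ⟨p, rfl⟩
    have hmono : ∀ (κ : Measure (Fin k → unitInterval)) [IsFiniteMeasure κ] (a : Fin k → ℕ),
        Integrable (fun x => ∏ i, (x i : ℝ) ^ a i) κ := by
      intro κ _ a
      refine Integrable.of_bound (C := 1) (Continuous.aestronglyMeasurable (by fun_prop))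
        (.of_forall fun x => ?_)
      rw [Real.norm_of_nonneg (Finset.prod_nonneg fun i _ => pow_nonneg (x i).2.1 _)]
      exact Finset.prod_le_one (fun i _ => pow_nonneg (x i).2.1 _)
        fun i _ => pow_le_one₀ (x i).2.1 (x i).2.2
    have heval : ∀ x : Fin k → unitInterval, (MvPolynomial.aeval (R := ℝ) coord p) x =
        ∑ a ∈ p.support, p.coeff a * ∏ i, (x i : ℝ) ^ a i := by
      intro x
      rw [MvPolynomial.aeval_def, MvPolynomial.eval₂_eq']
      simp [coord]
    simp only [AlgHom.toRingHom_eq_coe, RingHom.coe_coe, heval]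
    have hsum : ∀ (κ : Measure (Fin k → unitInterval)) [IsFiniteMeasure κ],
        ∫ x, ∑ a ∈ p.support, p.coeff a * ∏ i, (x i : ℝ) ^ a i ∂κ =
          ∑ a ∈ p.support, p.coeff a * ∫ x, ∏ i, (x i : ℝ) ^ a i ∂κ := by
      intro κ _
      rw [integral_finsetSum]
      · exact Finset.sum_congr rfl fun a _ => integral_const_mul _ _
      · exact fun a _ => (hmono κ a).const_mul _
    rw [hsum, hsum]
    exact Finset.sum_congr rfl fun a _ => by rw [h]

/-- Since `halfPow` is injective, it embeds the extended counts in the cube, where moments determine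
the law. Integer powers of `2^{-n}` thus suffice, and infinite counts need no separate treatment. -/
theorem measure_enat_ext_of_halfPow {k : ℕ} {Q Q' : Measure (Fin k → ℕ∞)}
    [IsFiniteMeasure Q] [IsFiniteMeasure Q']
    (h : ∀ a : Fin k → ℕ,
      ∫ x, ∏ i, halfPow (x i) ^ a i ∂Q = ∫ x, ∏ i, halfPow (x i) ^ a i ∂Q') :
    Q = Q' := by
  let W : (Fin k → ℕ∞) → Fin k → unitInterval := fun x i =>
    ⟨halfPow (x i), halfPow_mem_unitInterval _⟩
  have hW : Measurable W := .of_discrete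
  have hinj : Function.Injective W := fun x y hxy =>
    funext fun i => halfPow_injective (congrArg Subtype.val (congrFun hxy i))
  have hmap : Q.map W = Q'.map W := by
    refine measure_unitInterval_ext_of_moments fun a => ?_
    have hc : ∀ R : Measure (Fin k → unitInterval), AEStronglyMeasurable
        (fun x : Fin k → unitInterval => ∏ i, (x i : ℝ) ^ a i) R := fun R =>
      Continuous.aestronglyMeasurable (by fun_prop)
    rw [integral_map hW.aemeasurable (hc _), integral_map hW.aemeasurable (hc _)]
    exact h a
  ext s -
  have hs : W ⁻¹' (W '' s) = s := hinj.preimage_image s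
  have hms : MeasurableSet (W '' s) := ((Set.to_countable s).image W).measurableSet
  rw [← hs, ← Measure.map_apply hW hms, hmap, Measure.map_apply hW hms]

theorem integral_pow_poissonMeasure (r : ℝ≥0) (s : ℝ) :
    ∫ n, s ^ n ∂poissonMeasure r = Real.exp (-(r * (1 - s))) := by
  rw [integral_poissonMeasure]
  calc ∑' n : ℕ, (Real.exp (-r) * r ^ n / n.factorial) • s ^ n
      = ∑' n : ℕ, Real.exp (-r) * ((r * s) ^ n / n.factorial) := by
        refine tsum_congr fun n => ?_
        rw [smul_eq_mul, mul_pow]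
        ring
    _ = Real.exp (-r) * Real.exp (r * s) := by
        rw [tsum_mul_left, Real.exp_eq_exp_ℝ, NormedSpace.exp_eq_tsum_div]
    _ = _ := by
        rw [← Real.exp_add]
        congr 1
        ring

/-- The value at `2^{-a}` of the probability generating function of the Poisson law. -/
noncomputable def poissonPGF (a : ℕ) (r : ℝ≥0∞) : ℝ :=
  if a = 0 then 1 else if r = ∞ then 0 else Real.exp (-(r.toReal * (1 - 2⁻¹ ^ a)))

theorem integral_halfPow_poissonLaw (a : ℕ) (r : ℝ≥0∞) :
    ∫ n, halfPow n ^ a ∂poissonLaw r = poissonPGF a r := by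
  by_cases ha : a = 0
  · simp [ha, poissonPGF]
  rw [poissonPGF, if_neg ha]
  by_cases hr : r = ∞
  · rw [if_pos hr, poissonLaw, if_pos hr, integral_dirac, halfPow_top, zero_pow ha]
  · rw [if_neg hr, poissonLaw, if_neg hr, integral_map .of_discrete
      (Measurable.of_discrete).aestronglyMeasurable]
    simp only [halfPow_natCast, ← pow_mul, mul_comm _ a]
    simp only [pow_mul]
    exact integral_pow_poissonMeasure _ _

/-- Continuity up to infinite mean is what allows a process of infinite intensity to be built from
finite pieces. -/
theorem tendsto_poissonPGF {r : ℕ → ℝ≥0∞} {R : ℝ≥0∞} (hr : ∀ n, r n ≠ ∞)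
    (hR : Tendsto r atTop (𝓝 R)) (a : ℕ) :
    Tendsto (fun n => poissonPGF a (r n)) atTop (𝓝 (poissonPGF a R)) := by
  by_cases ha : a = 0
  · simp [ha, poissonPGF]
  simp only [poissonPGF, if_neg ha, if_neg (hr _)]
  by_cases hRt : R = ∞
  · rw [if_pos hRt]
    have ht : Tendsto (fun n => (r n).toReal) atTop atTop := by
      rw [hRt] at hR
      refine tendsto_atTop.2 fun b => ?_
      filter_upwards [hR.eventually (lt_mem_nhds (ENNReal.ofReal_lt_top (r := b)))] with n hn
      exact (ENNReal.ofReal_le_iff_le_toReal (hr n)).1 hn.le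
    refine Real.tendsto_exp_neg_atTop_nhds_zero.comp ?_
    refine ht.atTop_mul_const ?_
    have : (2⁻¹ : ℝ) ^ a < 1 := pow_lt_one₀ (by norm_num) (by norm_num) ha
    linarith
  · rw [if_neg hRt]
    refine (Real.continuous_exp.tendsto _).comp (Tendsto.neg ?_)
    exact ((ENNReal.tendsto_toReal hRt).comp hR).mul_const _

theorem integral_prod_range_infinitePi {E : ℕ → Type*} [∀ n, MeasurableSpace (E n)]
    {κ : (n : ℕ) → Measure (E n)} [∀ n, IsProbabilityMeasure (κ n)] {f : (n : ℕ) → E n → ℝ}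
    (hf : ∀ n, Measurable (f n)) (M : ℕ) :
    ∫ ω, ∏ n ∈ Finset.range M, f n (ω n) ∂Measure.infinitePi κ =
      ∏ n ∈ Finset.range M, ∫ x, f n x ∂κ n := by
  have hmeas : Measurable fun y : (i : Finset.range M) → E i => ∏ i : Finset.range M, f i (y i) :=
    Finset.measurable_prod _ fun i _ => (hf i).comp (measurable_pi_apply i)
  have h := integral_restrict_infinitePi κ (s := Finset.range M) hmeas.aestronglyMeasurable
  rw [integral_fintype_prod_eq_prod (fun i : Finset.range M => f i)] at h
  rw [← Finset.prod_coe_sort (Finset.range M) fun n => ∫ x, f n x ∂κ n, ← h]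
  refine integral_congr_ae (.of_forall fun ω => ?_)
  exact (Finset.prod_coe_sort (Finset.range M) fun n => f n (ω n)).symm

theorem natCast_lt_encard_iff {S : Set ℕ} {i : ℕ} :
    (i : ℕ∞) < S.encard ↔ ∀ hf : S.Finite, i < hf.toFinset.card := by
  by_cases hS : S.Finite
  · rw [hS.encard_eq_coe_toFinset_card]
    simp [hS]
  · simp [Set.Infinite.encard_eq hS, hS]

section Enumeration

open Classical in
theorem measurable_count_mem {Ω : Type*} [MeasurableSpace Ω] {S : Ω → Set ℕ}
    (hS : ∀ n, MeasurableSet {ω | n ∈ S ω}) (k : ℕ) :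
    Measurable fun ω => Nat.count (fun n => n ∈ S ω) k := by
  induction k with
  | zero => simp
  | succ k ih =>
    simp only [Nat.count_succ]
    exact ih.add (Measurable.ite (hS k) measurable_const measurable_const)

theorem measurable_nth {Ω : Type*} [MeasurableSpace Ω] {S : Ω → Set ℕ}
    (hS : ∀ n, MeasurableSet {ω | n ∈ S ω}) (i : ℕ) :
    Measurable fun ω => Nat.nth (fun n => n ∈ S ω) i := by
  classical
  -- `Nat.nth` returns `0` when there is no `i`-th element, so only nonzero values identify an
  -- element. The value `0` is handled afterwards by complement.
  have hpos : ∀ k, k ≠ 0 →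
      MeasurableSet ((fun ω => Nat.nth (fun n => n ∈ S ω) i) ⁻¹' {k}) := by
    intro k hk
    have h : (fun ω => Nat.nth (fun n => n ∈ S ω) i) ⁻¹' {k} =
        {ω | k ∈ S ω} ∩ {ω | Nat.count (fun n => n ∈ S ω) k = i} := by
      ext ω
      simp only [mem_preimage, mem_singleton_iff, mem_inter_iff, mem_ofPred_eq]
      constructor
      · intro h
        have h0 : Nat.nth (fun n => n ∈ S ω) i ≠ 0 := h ▸ hk
        have h1 := Nat.nth_mem_of_ne_zero h0
        have h2 := Nat.count_nth (fun hf => Nat.lt_card_toFinset_of_nth_ne_zero h0 hf)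
        rw [h] at h1 h2
        exact ⟨h1, h2⟩
      · rintro ⟨h1, rfl⟩
        exact Nat.nth_count (p := fun n => n ∈ S ω) h1
    rw [h]
    exact (hS k).inter (measurable_count_mem hS k (measurableSet_singleton i))
  refine measurable_to_countable' fun k => ?_
  by_cases hk : k = 0
  · have h : (fun ω => Nat.nth (fun n => n ∈ S ω) i) ⁻¹' {k} =
        (⋃ (j : ℕ) (_ : j ≠ 0), (fun ω => Nat.nth (fun n => n ∈ S ω) i) ⁻¹' {j})ᶜ := by
      ext ω
      simp only [mem_preimage, mem_singleton_iff, mem_compl_iff, mem_iUnion, hk, not_exists]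
      exact ⟨fun h j hj hj' => hj (hj'.symm.trans h), fun h => by_contra fun h0 => h _ h0 rfl⟩
    rw [h]
    exact (MeasurableSet.iUnion fun j => .iUnion fun hj => hpos j hj).compl
  · exact hpos k hk

variable {Ω X : Type}

/-- The configuration of the points `x n` with `n` in a random set `S` of indices. -/
noncomputable def PointConfiguration.ofIndexed (S : Ω → Set ℕ) (x : ℕ → Ω → X) :
    PointConfiguration Ω X where
  number ω := (S ω).encard
  point i ω := x (Nat.nth (fun n => n ∈ S ω) i) ω

theorem PointConfiguration.count_ofIndexed (S : Ω → Set ℕ) (x : ℕ → Ω → X) (A : Set X) (ω : Ω) :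
    (PointConfiguration.ofIndexed S x).count A ω = {n | n ∈ S ω ∧ x n ω ∈ A}.encard := by
  classical
  let e := Nat.nth fun n => n ∈ S ω
  have himage : e '' {i : ℕ | (i : ℕ∞) < (S ω).encard ∧ x (e i) ω ∈ A} =
      {n | n ∈ S ω ∧ x n ω ∈ A} := by
    ext n
    constructor
    · rintro ⟨i, ⟨hi, hA⟩, rfl⟩
      exact ⟨Nat.nth_mem i (natCast_lt_encard_iff.1 hi), hA⟩
    · rintro ⟨hn, hA⟩
      obtain ⟨i, hi, hin⟩ := Nat.exists_lt_card_nth_eq (p := fun n => n ∈ S ω) hn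
      have hin' : e i = n := hin
      exact ⟨i, ⟨natCast_lt_encard_iff.2 hi, by rwa [hin']⟩, hin⟩
  rw [← himage, InjOn.encard_image]
  · rfl
  · rintro i ⟨hi, -⟩ j ⟨hj, -⟩ hij
    rw [← Nat.count_nth (p := fun n => n ∈ S ω) (natCast_lt_encard_iff.1 hi),
      ← Nat.count_nth (p := fun n => n ∈ S ω) (natCast_lt_encard_iff.1 hj)]
    exact congrArg _ hij

variable [MeasurableSpace Ω] [MeasurableSpace X] {S : Ω → Set ℕ} {x : ℕ → Ω → X}

theorem PointConfiguration.measurable_point_ofIndexed (hS : ∀ n, MeasurableSet {ω | n ∈ S ω})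
    (hx : ∀ n, Measurable (x n)) (i : ℕ) :
    Measurable ((PointConfiguration.ofIndexed S x).point i) :=
  (measurable_from_prod_countable_right (f := fun p : ℕ × Ω => x p.1 p.2) hx).comp
    ((measurable_nth hS i).prodMk measurable_id)

theorem PointConfiguration.measurable_count_ofIndexed (hS : ∀ n, MeasurableSet {ω | n ∈ S ω})
    (hx : ∀ n, Measurable (x n)) {A : Set X} (hA : MeasurableSet A) :
    Measurable ((PointConfiguration.ofIndexed S x).count A) := by
  have : (PointConfiguration.ofIndexed S x).count A =
      fun ω => {n | n ∈ S ω ∧ x n ω ∈ A}.encard :=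
    funext fun ω => PointConfiguration.count_ofIndexed S x A ω
  rw [this]
  exact measurable_encard.comp (measurable_set_iff.2 fun n =>
    measurableSet_setOfPred.1 ((hS n).inter (hx n hA)))

end Enumeration

end CountingLaws

/-! ### Construction of Poisson processes with s-finite intensity. -/

section PoissonExistence

open Set Filter Topology

theorem poissonPGF_of_ne_top {r : ℝ≥0∞} (hr : r ≠ ∞) (a : ℕ) :
    poissonPGF a r = Real.exp (-(r.toReal * (1 - 2⁻¹ ^ a))) := by
  by_cases ha : a = 0
  · simp [poissonPGF, ha]
  · rw [poissonPGF, if_neg ha, if_neg hr]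

theorem poissonPGF_sum (a : ℕ) {ι : Type*} (s : Finset ι) {r : ι → ℝ≥0∞}
    (hr : ∀ n, r n ≠ ∞) : poissonPGF a (∑ n ∈ s, r n) = ∏ n ∈ s, poissonPGF a (r n) := by
  rw [poissonPGF_of_ne_top (ENNReal.sum_ne_top.2 fun n _ => hr n)]
  simp only [poissonPGF_of_ne_top (hr _)]
  rw [← Real.exp_sum, ENNReal.toReal_sum fun n _ => hr n, Finset.sum_neg_distrib, Finset.sum_mul]

variable {X : Type}

open Classical in
/-- The product of the weights `2^{-a i}` of those sets `A i` that contain `x`. -/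
noncomputable def weightProd {k : ℕ} (A : Fin k → Set X) (a : Fin k → ℕ) (x : X) : ℝ :=
  ∏ i, if x ∈ A i then 2⁻¹ ^ a i else 1

theorem weightProd_nonneg {k : ℕ} (A : Fin k → Set X) (a : Fin k → ℕ) (x : X) :
    0 ≤ weightProd A a x :=
  Finset.prod_nonneg fun i _ => by split_ifs <;> positivity

theorem weightProd_le_one {k : ℕ} (A : Fin k → Set X) (a : Fin k → ℕ) (x : X) :
    weightProd A a x ≤ 1 := by
  refine Finset.prod_le_one (fun i _ => by split_ifs <;> positivity) fun i _ => ?_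
  split_ifs
  · exact pow_le_one₀ (by norm_num) (by norm_num)
  · exact le_rfl

theorem weightProd_eq {k : ℕ} {A : Fin k → Set X}
    (hdisj : Pairwise fun i j => Disjoint (A i) (A j)) (a : Fin k → ℕ) (x : X) :
    weightProd A a x = 1 - ∑ i, (A i).indicator (fun _ => 1 - (2⁻¹ : ℝ) ^ a i) x := by
  classical
  by_cases h : ∃ i, x ∈ A i
  · obtain ⟨i, hi⟩ := h
    have hj : ∀ j, j ≠ i → x ∉ A j := fun j hj hx => (hdisj hj).le_bot ⟨hx, hi⟩
    rw [weightProd, Finset.prod_eq_single i (fun j _ hji => if_neg (hj j hji)) (by simp),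
      if_pos hi, Finset.sum_eq_single i (fun j _ hji => indicator_of_notMem (hj j hji) _)
        (by simp), indicator_of_mem hi]
    ring
  · push Not at h
    rw [weightProd, Finset.prod_eq_one fun i _ => if_neg (h i),
      Finset.sum_eq_zero fun i _ => indicator_of_notMem (h i) _, sub_zero]

open Classical in
/-- The codes of the active points among the first `M` rows of samples that lie in `A`. -/
noncomputable def sampleIndices (A : Set X) (M : ℕ) (ω : ℕ → ℕ × (ℕ → X)) : Finset ℕ :=
  ((Finset.range M).sigma fun n => (Finset.range (ω n).1).filter fun j => (ω n).2 j ∈ A).map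
    ((Equiv.sigmaEquivProd ℕ ℕ).trans Nat.pairEquiv).toEmbedding

/-- Rewriting the weight of the counts as a product over sample points makes independence usable row
by row and point by point. -/
theorem prod_pow_card_sampleIndices {k : ℕ} (A : Fin k → Set X) (a : Fin k → ℕ) (M : ℕ)
    (ω : ℕ → ℕ × (ℕ → X)) :
    ∏ i, ((2⁻¹ : ℝ) ^ (sampleIndices (A i) M ω).card) ^ a i =
      ∏ n ∈ Finset.range M, ∏ j ∈ Finset.range (ω n).1, weightProd A a ((ω n).2 j) := by
  classical
  have h : ∀ i, ((2⁻¹ : ℝ) ^ (sampleIndices (A i) M ω).card) ^ a i =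
      ∏ n ∈ Finset.range M, ∏ j ∈ Finset.range (ω n).1,
        if (ω n).2 j ∈ A i then (2⁻¹ : ℝ) ^ a i else 1 := by
    intro i
    rw [sampleIndices, Finset.card_map, Finset.card_sigma, ← Finset.prod_pow_eq_pow_sum,
      ← Finset.prod_pow]
    refine Finset.prod_congr rfl fun n _ => ?_
    rw [Finset.prod_ite, Finset.prod_const_one, mul_one, Finset.prod_const, ← pow_mul, ← pow_mul,
      mul_comm]
  simp only [h, weightProd]
  rw [Finset.prod_comm]
  exact Finset.prod_congr rfl fun n _ => Finset.prod_comm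

theorem mem_sampleIndices {A : Set X} {M : ℕ} {ω : ℕ → ℕ × (ℕ → X)} {t : ℕ} :
    t ∈ sampleIndices A M ω ↔ t.unpair.1 < M ∧ t.unpair.2 < (ω t.unpair.1).1 ∧
      (ω t.unpair.1).2 t.unpair.2 ∈ A := by
  classical
  constructor
  · intro ht
    obtain ⟨⟨n, j⟩, hp, hpt⟩ := Finset.mem_map.1 ht
    have hpair : Nat.pair n j = t := hpt
    obtain ⟨hn, hj⟩ := Finset.mem_sigma.1 hp
    obtain ⟨hj, hjA⟩ := Finset.mem_filter.1 hj
    rw [← hpair, Nat.unpair_pair]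
    exact ⟨Finset.mem_range.1 hn, Finset.mem_range.1 hj, hjA⟩
  · rintro ⟨h1, h2, h3⟩
    refine Finset.mem_map.2 ⟨⟨t.unpair.1, t.unpair.2⟩, ?_, Nat.pair_unpair t⟩
    exact Finset.mem_sigma.2 ⟨Finset.mem_range.2 h1,
      Finset.mem_filter.2 ⟨Finset.mem_range.2 h2, h3⟩⟩

variable [MeasurableSpace X]

theorem exists_isProbabilityMeasure_eq_smul [Nonempty X] (ν : Measure X) [IsFiniteMeasure ν] :
    ∃ ρ : Measure X, IsProbabilityMeasure ρ ∧ ν = ν univ • ρ := by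
  by_cases h0 : ν univ = 0
  · refine ⟨Measure.dirac (Classical.arbitrary X), inferInstance, ?_⟩
    rw [h0, zero_smul]
    exact Measure.measure_univ_eq_zero.1 h0
  · refine ⟨(ν univ)⁻¹ • ν, ⟨?_⟩, ?_⟩
    · rw [Measure.smul_apply, smul_eq_mul, ENNReal.inv_mul_cancel h0 (measure_ne_top _ _)]
    · rw [smul_smul, ENNReal.mul_inv_cancel h0 (measure_ne_top _ _), one_smul]

theorem measurable_weightProd {k : ℕ} {A : Fin k → Set X} (hA : ∀ i, MeasurableSet (A i))
    (a : Fin k → ℕ) : Measurable (weightProd A a) :=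
  Finset.measurable_prod _ fun i _ => Measurable.ite (hA i) measurable_const measurable_const

theorem integral_weightProd {ρ : Measure X} [IsProbabilityMeasure ρ] {k : ℕ}
    {A : Fin k → Set X} (hA : ∀ i, MeasurableSet (A i))
    (hdisj : Pairwise fun i j => Disjoint (A i) (A j)) (a : Fin k → ℕ) :
    ∫ x, weightProd A a x ∂ρ = 1 - ∑ i, ρ.real (A i) * (1 - 2⁻¹ ^ a i) := by
  simp only [weightProd_eq hdisj]
  have hint : ∀ i, Integrable ((A i).indicator fun _ => 1 - (2⁻¹ : ℝ) ^ a i) ρ := fun i =>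
    (integrable_const _).indicator (hA i)
  rw [integral_sub (integrable_const _) (integrable_finsetSum _ fun i _ => hint i),
    integral_finsetSum _ fun i _ => hint i]
  simp only [integral_indicator (hA _)]
  simp

/-- The law of a Poisson number of independent points with common law `ρ`. -/
noncomputable def poissonSampleLaw (r : ℝ≥0) (ρ : Measure X) : Measure (ℕ × (ℕ → X)) :=
  (poissonMeasure r).prod (Measure.infinitePi fun _ : ℕ => ρ)

instance (r : ℝ≥0) (ρ : Measure X) [IsProbabilityMeasure ρ] :
    IsProbabilityMeasure (poissonSampleLaw r ρ) := by
  unfold poissonSampleLaw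
  infer_instance

theorem measurable_prod_range_weightProd {k : ℕ} {A : Fin k → Set X}
    (hA : ∀ i, MeasurableSet (A i)) (a : Fin k → ℕ) :
    Measurable fun p : ℕ × (ℕ → X) => ∏ j ∈ Finset.range p.1, weightProd A a (p.2 j) :=
  measurable_from_prod_countable_right fun N =>
    (Finset.measurable_prod (Finset.range N) fun j _ =>
      (measurable_weightProd hA a).comp (measurable_pi_apply j) :
        Measurable fun y : ℕ → X => ∏ j ∈ Finset.range N, weightProd A a (y j))

/-- Given the number of points, the integral is a power of the mean weight `s = 1 - ∑ ρ(A i)(1 -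
2^{-a i})`. The Poisson generating function `exp(-r(1 - s))` then factors over `i`, which encodes
the independence of the counts. -/
theorem integral_poissonSampleLaw {ν ρ : Measure X} [IsFiniteMeasure ν] [IsProbabilityMeasure ρ]
    (hν : ν = ν univ • ρ) {k : ℕ} {A : Fin k → Set X} (hA : ∀ i, MeasurableSet (A i))
    (hdisj : Pairwise fun i j => Disjoint (A i) (A j)) (a : Fin k → ℕ) :
    ∫ p, ∏ j ∈ Finset.range p.1, weightProd A a (p.2 j)
        ∂poissonSampleLaw (ν univ).toNNReal ρ = ∏ i, poissonPGF (a i) (ν (A i)) := by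
  have hbound : ∀ p : ℕ × (ℕ → X),
      ‖∏ j ∈ Finset.range p.1, weightProd A a (p.2 j)‖ ≤ 1 := by
    intro p
    rw [Real.norm_of_nonneg (Finset.prod_nonneg fun j _ => weightProd_nonneg A a _)]
    exact Finset.prod_le_one (fun j _ => weightProd_nonneg A a _)
      fun j _ => weightProd_le_one A a _
  have hA' : ∀ i, (ν (A i)).toReal = (ν univ).toNNReal * ρ.real (A i) := by
    intro i
    nth_rewrite 1 [hν]
    rw [Measure.smul_apply, smul_eq_mul, ENNReal.toReal_mul]
    rfl
  rw [poissonSampleLaw, integral_prod _ (Integrable.of_bound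
    (measurable_prod_range_weightProd hA a).aestronglyMeasurable 1 (.of_forall hbound))]
  simp only [integral_prod_range_infinitePi (fun _ => measurable_weightProd hA a),
    Finset.prod_const, Finset.card_range]
  rw [integral_pow_poissonMeasure, integral_weightProd hA hdisj, sub_sub_cancel]
  simp only [poissonPGF_of_ne_top (measure_ne_top ν _)]
  rw [← Real.exp_sum, Finset.sum_neg_distrib, Finset.mul_sum]
  simp only [hA', mul_assoc]

theorem integral_halfPow_pi_poissonLaw {k : ℕ} (r : Fin k → ℝ≥0∞) (a : Fin k → ℕ) :
    ∫ x, ∏ i, halfPow (x i) ^ a i ∂Measure.pi (fun i => poissonLaw (r i)) =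
      ∏ i, poissonPGF (a i) (r i) := by
  rw [integral_fintype_prod_eq_prod (fun i n => halfPow n ^ a i)]
  simp only [integral_halfPow_poissonLaw]

/-- Poisson processes are characterized by the generating functions of their counts. -/
theorem isPoissonProcess_of_integral_halfPow {Ω : Type} [MeasurableSpace Ω] {P : Measure Ω}
    [IsProbabilityMeasure P] {Φ : PointConfiguration Ω X} {m : Measure X}
    (hnumber : Measurable Φ.number) (hpoint : ∀ i, Measurable (Φ.point i))
    (hcount : ∀ A, MeasurableSet A → Measurable (Φ.count A))
    (h : ∀ (k : ℕ) (A : Fin k → Set X), (∀ i, MeasurableSet (A i)) →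
      (Pairwise fun i j => Disjoint (A i) (A j)) → ∀ a : Fin k → ℕ,
        ∫ ω, ∏ i, halfPow (Φ.count (A i) ω) ^ a i ∂P = ∏ i, poissonPGF (a i) (m (A i))) :
    IsPoissonProcess P Φ m := by
  have hjoint : ∀ (k : ℕ) (A : Fin k → Set X), (∀ i, MeasurableSet (A i)) →
      (Pairwise fun i j => Disjoint (A i) (A j)) →
        P.map (fun ω i => Φ.count (A i) ω) = Measure.pi fun i => poissonLaw (m (A i)) := by
    intro k A hA hdisj
    have hm : Measurable fun ω i => Φ.count (A i) ω :=
      measurable_pi_lambda _ fun i => hcount _ (hA i)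
    have : IsProbabilityMeasure (P.map fun ω i => Φ.count (A i) ω) :=
      Measure.isProbabilityMeasure_map hm.aemeasurable
    refine measure_enat_ext_of_halfPow fun a => ?_
    rw [integral_halfPow_pi_poissonLaw, integral_map hm.aemeasurable
      (Measurable.of_discrete).aestronglyMeasurable]
    exact h k A hA hdisj a
  have hmap : ∀ A : Set X, MeasurableSet A → P.map (Φ.count A) = poissonLaw (m A) := by
    intro A hA
    have h1 := hjoint 1 (fun _ => A) (fun _ => hA)
      (fun i j hij => absurd (Subsingleton.elim i j) hij)
    have h2 := (measurePreserving_eval (fun _ : Fin 1 => poissonLaw (m A)) 0).map_eq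
    rw [← h1, Measure.map_map (measurable_pi_apply 0)
      (measurable_pi_lambda _ fun _ => hcount _ hA)] at h2
    exact h2
  refine ⟨hnumber, hpoint, hmap, fun k A hA hdisj => ?_⟩
  rw [iIndepFun_iff_map_fun_eq_pi_map fun i => (hcount _ (hA i)).aemeasurable, hjoint k A hA hdisj]
  simp only [hmap _ (hA _)]

/-- Every s-finite measure is the intensity measure of some Poisson process. -/
theorem exists_isPoissonProcess [Nonempty X] (m : Measure X) [SFinite m] :
    ∃ (Ω : Type) (_ : MeasurableSpace Ω) (P : Measure Ω) (_ : IsProbabilityMeasure P)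
      (Φ : PointConfiguration Ω X), IsPoissonProcess P Φ m := by
  classical
  let ν := sfiniteSeq m
  choose ρ hρ hνρ using fun n => exists_isProbabilityMeasure_eq_smul (ν n)
  let P : Measure (ℕ → ℕ × (ℕ → X)) :=
    Measure.infinitePi fun n => poissonSampleLaw (ν n univ).toNNReal (ρ n)
  -- Row `n` carries the points of the finite measure `ν n`. An index encodes a row and a position,
  -- and is active when the position is below the Poisson number of that row.
  let S : (ℕ → ℕ × (ℕ → X)) → Set ℕ := fun ω => {t | t.unpair.2 < (ω t.unpair.1).1}
  let x : ℕ → (ℕ → ℕ × (ℕ → X)) → X := fun t ω => (ω t.unpair.1).2 t.unpair.2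
  have hS : ∀ t, MeasurableSet {ω | t ∈ S ω} := fun t =>
    (measurable_fst.comp (measurable_pi_apply t.unpair.1)) measurableSet_Ioi
  have hx : ∀ t, Measurable (x t) := fun t =>
    (measurable_pi_apply _).comp (measurable_snd.comp (measurable_pi_apply t.unpair.1))
  have hcount : ∀ A : Set X, MeasurableSet A →
      Measurable ((PointConfiguration.ofIndexed S x).count A) := fun A hA =>
    PointConfiguration.measurable_count_ofIndexed hS hx hA
  refine ⟨_, inferInstance, P, inferInstance, PointConfiguration.ofIndexed S x,
    isPoissonProcess_of_integral_halfPow ?_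
      (fun i => PointConfiguration.measurable_point_ofIndexed hS hx i) hcount ?_⟩
  · exact measurable_encard.comp (measurable_set_iff.2 fun t => measurableSet_setOfPred.1 (hS t))
  intro k A hA hdisj a
  have hlim : ∀ ω, Tendsto
      (fun M => ∏ n ∈ Finset.range M, ∏ j ∈ Finset.range (ω n).1, weightProd A a ((ω n).2 j)) atTop
      (𝓝 (∏ i, halfPow ((PointConfiguration.ofIndexed S x).count (A i) ω) ^ a i)) := by
    intro ω
    simp only [← prod_pow_card_sampleIndices]
    refine tendsto_finsetProd _ fun i _ => Tendsto.pow ?_ _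
    rw [PointConfiguration.count_ofIndexed]
    refine tendsto_pow_card_halfPow_encard (fun M t ht => ?_) fun t ht => ?_
    · exact (mem_sampleIndices.1 ht).2
    · filter_upwards [eventually_gt_atTop t.unpair.1] with M hM
      exact mem_sampleIndices.2 ⟨hM, ht⟩
  have hmeas : ∀ M, Measurable fun ω : ℕ → ℕ × (ℕ → X) =>
      ∏ n ∈ Finset.range M, ∏ j ∈ Finset.range (ω n).1, weightProd A a ((ω n).2 j) := fun M =>
    Finset.measurable_prod _ fun n _ =>
      (measurable_prod_range_weightProd hA a).comp (measurable_pi_apply n)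
  have hdom := tendsto_integral_of_dominated_convergence (μ := P) (fun _ => (1 : ℝ))
    (fun M => (hmeas M).aestronglyMeasurable) (integrable_const _)
    (fun M => .of_forall fun ω => by
      rw [Real.norm_of_nonneg (Finset.prod_nonneg fun n _ => Finset.prod_nonneg fun j _ =>
        weightProd_nonneg A a _)]
      exact Finset.prod_le_one
        (fun n _ => Finset.prod_nonneg fun j _ => weightProd_nonneg A a _)
        fun n _ => Finset.prod_le_one (fun j _ => weightProd_nonneg A a _)
          fun j _ => weightProd_le_one A a _)
    (.of_forall hlim)
  refine tendsto_nhds_unique hdom ?_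
  have hval : ∀ M, ∫ ω, ∏ n ∈ Finset.range M, ∏ j ∈ Finset.range (ω n).1,
      weightProd A a ((ω n).2 j) ∂P =
        ∏ i, poissonPGF (a i) (∑ n ∈ Finset.range M, ν n (A i)) := by
    intro M
    refine (integral_prod_range_infinitePi (E := fun _ => ℕ × (ℕ → X))
      (f := fun _ p => ∏ j ∈ Finset.range p.1, weightProd A a (p.2 j))
      (fun n => measurable_prod_range_weightProd hA a) M).trans ?_
    simp only [poissonPGF_sum _ _ fun n => measure_ne_top (ν n) _]
    rw [Finset.prod_comm]
    exact Finset.prod_congr rfl fun n _ => integral_poissonSampleLaw (hνρ n) hA hdisj a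
  simp only [hval]
  refine tendsto_finsetProd _ fun i _ => tendsto_poissonPGF
    (fun M => ENNReal.sum_ne_top.2 fun n _ => measure_ne_top _ _) ?_ _
  have hm : m (A i) = ∑' n, ν n (A i) := by
    rw [← Measure.sum_apply _ (hA i), sum_sfiniteSeq]
  rw [hm]
  exact ENNReal.summable.hasSum.tendsto_sum_nat

/-- The image of a Poisson process under a measurable map is a Poisson process. -/
theorem IsPoissonProcess.map {Ω Y : Type} [MeasurableSpace Ω] [MeasurableSpace Y]
    {P : Measure Ω} {Φ : PointConfiguration Ω X} {m : Measure X} (hΦ : IsPoissonProcess P Φ m)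
    {f : X → Y} (hf : Measurable f) :
    IsPoissonProcess P ⟨Φ.number, fun i ω => f (Φ.point i ω)⟩ (m.map f) where
  measurable_number := hΦ.measurable_number
  measurable_point i := hf.comp (hΦ.measurable_point i)
  map_count A hA := by
    rw [Measure.map_apply hf hA]
    exact hΦ.map_count _ (hf hA)
  indep_count n A hA hdisj :=
    hΦ.indep_count n (fun i => f ⁻¹' A i) (fun i => hf (hA i)) fun _ _ hij =>
      (hdisj hij).preimage f

end PoissonExistence

/-! ### The common critical value. -/

section CriticalValue

open Set Filter Topology Metric

variable {d : ℕ} [MeasurableSpace (SmallSet d)] {μ : Measure (SmallSet d)}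

instance : Nonempty (SmallSet d) := ⟨⟨∅, by simp⟩⟩

theorem le_closureMeasure_closedBall_subset (hF : IsSuitableSigmaAlgebra d)
    (x : EuclideanSpace ℝ (Fin d)) (r : ℝ) :
    μ {G | closedBall x r ⊆ G.carrier} ≤ closureMeasure μ {G | closedBall x r ⊆ G.carrier} := by
  rw [closureMeasure, Measure.map_apply hF.closure (hF.contains _ (isCompact_closedBall _ _))]
  exact measure_mono fun G (hG : closedBall x r ⊆ G.carrier) =>
    (hG.trans subset_closure : closedBall x r ⊆ closure G.carrier)

theorem exists_linear_le_measure_closedBall_subset (hF : IsSuitableSigmaAlgebra d)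
    (hscale : SemiScaleInvariant μ) (htrans : TranslationInvariant μ)
    (hopen : SupportedOnOpen μ) (h1 : LocallyFiniteModel μ) {l : ℝ≥0∞} (hl : l ≠ ∞)
    {t : ℝ} (ht0 : 0 ≤ t) (ht : ENNReal.ofReal t < l * scaleDensity μ) :
    ∃ a b : ℝ, t < a ∧ ∀ x (n : ℕ),
      ENNReal.ofReal (a * n - b) ≤ l * μ {G | closedBall x (2⁻¹ ^ n) ⊆ G.carrier} := by
  have hlim := ENNReal.Tendsto.const_mul (tendsto_measure_closedBall_subset hopen) (.inr hl)
  obtain ⟨J, hJ⟩ := (hlim.eventually_const_lt ht).exists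
  let p := μ ({G | closedBall 0 (2⁻¹ ^ J) ⊆ G.carrier} ∩ diamShell d 0)
  have hp : p ≠ ∞ := by
    refine ((measure_mono (inter_subset_inter_left _ fun G hG => ?_)).trans_lt
      (scaleDensity_lt_top h1)).ne
    exact hG (mem_closedBall_self (by positivity))
  have hlp : l * p ≠ ∞ := ENNReal.mul_ne_top hl hp
  refine ⟨(l * p).toReal, (l * p).toReal * J, (ENNReal.ofReal_lt_iff_lt_toReal ht0 hlp).1 hJ,
    fun x n => ?_⟩
  calc ENNReal.ofReal ((l * p).toReal * n - (l * p).toReal * J)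
      ≤ ENNReal.ofReal ((n - J : ℕ) * (l * p).toReal) := by
        apply ENNReal.ofReal_le_ofReal
        have h : (n : ℝ) ≤ (n - J : ℕ) + J := by
          exact_mod_cast le_tsub_add
        nlinarith [ENNReal.toReal_nonneg (a := l * p)]
    _ = (n - J : ℕ) * (l * p) := by
        rw [ENNReal.ofReal_mul (by positivity), ENNReal.ofReal_natCast, ENNReal.ofReal_toReal hlp]
    _ = l * ((n - J : ℕ) * p) := mul_left_comm _ _ _
    _ ≤ _ := by
        gcongr
        exact le_measure_closedBall_subset hF hscale htrans h1 x J n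

theorem fractalAlmostSurelyEmpty_of_lt (hd : 1 ≤ d) (hF : IsSuitableSigmaAlgebra d)
    (hscale : SemiScaleInvariant μ) (htrans : TranslationInvariant μ)
    (hopen : SupportedOnOpen μ) (h1 : LocallyFiniteModel μ) {l : ℝ≥0∞} (hl : l ≠ ∞)
    (ht : ENNReal.ofReal (d * Real.log 2) < l * scaleDensity μ) :
    FractalAlmostSurelyEmpty (l • μ) ∧ FractalAlmostSurelyEmpty (l • closureMeasure μ) := by
  obtain ⟨a, b, ha, hab⟩ := exists_linear_le_measure_closedBall_subset hF hscale htrans hopen h1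
    hl (by positivity) ht
  refine ⟨fractalAlmostSurelyEmpty_of_le hd hF ha fun x n => hab x n,
    fractalAlmostSurelyEmpty_of_le hd hF ha fun x n => (hab x n).trans ?_⟩
  rw [Measure.smul_apply, smul_eq_mul]
  gcongr l * ?_
  exact le_closureMeasure_closedBall_subset hF x _

/-- One realization serves both models: its closures do not cover the space with positive
probability, hence neither do the sets themselves. -/
theorem not_fractalAlmostSurelyEmpty_of_lt [SFinite μ] (hd : 1 ≤ d)
    (hF : IsSuitableSigmaAlgebra d) (hscale : SemiScaleInvariant μ)
    (htrans : TranslationInvariant μ) (hopen : SupportedOnOpen μ) (h1 : LocallyFiniteModel μ)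
    (h2 : NullBoundaries μ) {l : ℝ≥0∞} (hl : l ≠ ∞)
    (ht : l * scaleDensity μ < ENNReal.ofReal (d * Real.log 2)) :
    ¬ FractalAlmostSurelyEmpty (l • μ) ∧ ¬ FractalAlmostSurelyEmpty (l • closureMeasure μ) := by
  have hlim := ENNReal.Tendsto.const_mul (tendsto_measure_relThickening hF htrans h1 h2) (.inr hl)
  obtain ⟨j, hj⟩ := (hlim.eventually_lt_const ht).exists
  have hε : (2⁻¹ : ℝ≥0∞) ^ j ≤ 1 := pow_le_one' (by simp) j
  let c := l * μ (relThickening (2⁻¹ ^ j) 0 ∩ diamShell d 0)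
  have hc : c ≠ ∞ := (hj.trans ENNReal.ofReal_lt_top).ne
  have hexp : Real.exp c.toReal < 2 ^ d := by
    have h : (2 : ℝ) ^ d = Real.exp (d * Real.log 2) := by
      rw [Real.exp_nat_mul, Real.exp_log (by norm_num)]
    rw [h, Real.exp_lt_exp]
    exact (ENNReal.lt_ofReal_iff_toReal_lt hc).1 hj
  obtain ⟨Ω, _, P, _, Φ, hΦ⟩ := exists_isPoissonProcess (l • μ)
  have hnot := not_ae_forall_mem_closure_of_exp_lt hF (m := l • μ) (ε := 2⁻¹ ^ j) (by simp) hε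
    ENNReal.toReal_nonneg hexp (fun x k => by
      rw [Measure.smul_apply, smul_eq_mul,
        measure_relThickening_inter_diamShell hF hscale htrans h1 hε, ENNReal.ofReal_toReal hc])
    (Measure.ae_smul_measure (hopen.ae_eq_empty_or_ediam_ne_zero hd) l) hΦ
  constructor
  · intro hempty
    refine hnot ?_
    filter_upwards [hempty Ω P Φ hΦ] with ω hω x
    have hx : x ∈ ⋃ (i : ℕ) (_ : (i : ℕ∞) < Φ.number ω), (Φ.point i ω).carrier :=
      compl_empty_iff.1 hω ▸ mem_univ x
    obtain ⟨i, hi, hxi⟩ := mem_iUnion₂.1 hx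
    exact ⟨i, hi, subset_closure hxi⟩
  · intro hempty
    refine hnot ?_
    -- Taking the closure of every point of the realization gives a Poisson process for the closure
    -- measure on the same probability space.
    have hΦ' := hΦ.map hF.closure
    rw [Measure.map_smul] at hΦ'
    filter_upwards [hempty Ω P _ hΦ'] with ω hω x
    have hx : x ∈ ⋃ (i : ℕ) (_ : (i : ℕ∞) < Φ.number ω), (Φ.point i ω).closure.carrier :=
      compl_empty_iff.1 hω ▸ mem_univ x
    obtain ⟨i, hi, hxi⟩ := mem_iUnion₂.1 hx
    exact ⟨i, hi, hxi⟩

theorem existenceCriticalValue_eq_of_threshold {ν : Measure (SmallSet d)} {t : ℝ≥0∞}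
    (habove : ∀ l : ℝ≥0∞, l ≠ ∞ → t < l → FractalAlmostSurelyEmpty (l • ν))
    (hbelow : ∀ l : ℝ≥0∞, l < t → ¬ FractalAlmostSurelyEmpty (l • ν)) :
    existenceCriticalValue ν = t := by
  refine le_antisymm (le_of_forall_gt fun l hl => ?_) (le_sInf ?_)
  · obtain ⟨l', htl, hll⟩ := exists_between hl
    exact lt_of_le_of_lt
      (sInf_le ⟨pos_of_gt htl, (hll.trans_le le_top).ne,
        habove l' (hll.trans_le le_top).ne htl⟩) hll
  · rintro l ⟨-, -, hl⟩
    exact not_lt.1 fun hlt => hbelow l hlt hl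

end CriticalValue

theorem corollary1p4 (d : ℕ) (hd : 1 ≤ d) [MeasurableSpace (SmallSet d)]
    (hF : IsSuitableSigmaAlgebra d)
    (μ : Measure (SmallSet d))
    (hscale : SemiScaleInvariant μ) (htrans : TranslationInvariant μ)
    (hopen : SupportedOnOpen μ)
    (h1 : LocallyFiniteModel μ) (h2 : NullBoundaries μ) (h3 : PositiveVolumes μ) :
    existenceCriticalValue μ = existenceCriticalValue (closureMeasure μ) := by
  have := sFinite_of_locallyFiniteModel hd hF hopen h1
  have hc0 : scaleDensity μ ≠ 0 := (scaleDensity_pos hd hF hscale htrans hopen h1 h3).ne'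
  have hct : scaleDensity μ ≠ ∞ := (scaleDensity_lt_top h1).ne
  -- The threshold balances `exp(-λ c)` per scale against the factor `2^d` of new cells. It depends
  -- on `μ` only through quantities that the passage to closures leaves unaffected.
  let t : ℝ≥0∞ := ENNReal.ofReal (d * Real.log 2) / scaleDensity μ
  have habove : ∀ l : ℝ≥0∞, l ≠ ∞ → t < l → FractalAlmostSurelyEmpty (l • μ) ∧
      FractalAlmostSurelyEmpty (l • closureMeasure μ) := fun l hl htl =>
    fractalAlmostSurelyEmpty_of_lt hd hF hscale htrans hopen h1 hl
      ((ENNReal.div_lt_iff (.inl hc0) (.inl hct)).1 htl)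
  have hbelow : ∀ l : ℝ≥0∞, l < t → ¬ FractalAlmostSurelyEmpty (l • μ) ∧
      ¬ FractalAlmostSurelyEmpty (l • closureMeasure μ) := fun l hlt =>
    not_fractalAlmostSurelyEmpty_of_lt hd hF hscale htrans hopen h1 h2 (hlt.trans_le le_top).ne
      ((ENNReal.lt_div_iff_mul_lt (.inl hc0) (.inl hct)).1 hlt)
  rw [existenceCriticalValue_eq_of_threshold (fun l hl h => (habove l hl h).1)
      fun l h => (hbelow l h).1,
    existenceCriticalValue_eq_of_threshold (fun l hl h => (habove l hl h).2)
      fun l h => (hbelow l h).2]
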